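/- Let $\zeta:\mathcal A\to\mathcal A^+$ be a substitution on $\mathcal A=\{1,\dots,m\}$ whose substitution matrix $\mathsf S$, with $\mathsf S(i,j)$ = number of symbols $i$ in $\zeta(j)$, is primitive. Let $\theta=\theta_1,\theta_2,\dots,\theta_m$ be the eigenvalues of $\mathsf S$, counted with algebraic multiplicity and ordered by non-increasing modulus. Suppose that $m\ge 2$ and $|\theta_2|>1$, and that exactly $\alpha+1$ of the eigenvalues $\theta_1,\dots,\theta_m$ (counted with algebraic multiplicity) have modulus $|\theta_2|$. Put $\beta=\log_\theta|\theta_2|$. Let $X_\zeta\subset\mathcal A^{\mathbb Z}$ be the substitution space (all $x$ such that each block $x[-n,n]$ is a subword of some $\zeta^k(a)$), $T$ the left shift on $X_\zeta$, and $\mu$ its (unique) invariant Borel probability measure. For $\vec s=(s_1,\dots,s_m)$ with all $s_a>0$ and $\sum_a s_a=1$, let $\mathfrak X=\{(x,t): x\in X_\zeta,\ 0\le t\le s_{x_0}\}$, with $(x,s_{x_0})$ identified with $(Tx,0)$, let $h_t$ be the suspension flow (vertical translation) on $\mathfrak X$, and let $\widetilde\mu$ be its invariant probability measure, i.e. the normalized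 restriction of $\mu\times\mathrm{Leb}$ to $\mathfrak X$. A cylindrical function is a function $f(x,t)=\psi_{x_0}(t)$, $0\le t<s_{x_0}$, with Lipschitz functions $\psi_a:[0,s_a]\to\mathbb C$, $a\in\mathcal A$; put $\|f\|_\infty=\max_a\sup_{[0,s_a]}|\psi_a|$. Its spectral measure $\sigma_f$ is the finite positive Borel measure on $\mathbb R$ with $$\int_{\mathbb R}e^{2\pi i\omega t}\,d\sigma_f(\omega)=\int_{\mathfrak X}(f\circ h_t)\,\overline f\,d\widetilde\mu\qquad\text{for all }t\in\mathbb R.$$ Then for every such $\vec s$ there is a constant $C$, depending only on $\zeta$ and $\vec s$, such that for every cylindrical function $f$ with $\int f\,d\widetilde\mu=0$, $$\sigma_f([-r,r])\le C\,\|f\|_\infty^2\,\bigl(\log(1/r)\bigr)^{2\alpha}\,r^{2-2\beta}\qquad\text{for all }0<r\le\tfrac12 .$$ -/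

import Mathlib

open MeasureTheory

noncomputable section

namespace SubstFlow

/-- A substitution on the alphabet `Fin m`: every letter is sent to a nonempty word. -/
structure Substitution (m : ℕ) where
  word : Fin m → List (Fin m)
  word_ne_nil : ∀ a, word a ≠ []

namespace Substitution

variable {m : ℕ} (ζ : Substitution m)

/-- The extension of `ζ` to words by concatenation. -/
def apply (w : List (Fin m)) : List (Fin m) := w.flatMap ζ.word

/-- The word `ζ^k(a)`. -/
def iter (k : ℕ) (a : Fin m) : List (Fin m) := ζ.apply^[k] [a]

/-- The substitution matrix: the entry `(i, j)` is the number of symbols `i` in `ζ(j)`. -/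
def matrix : Matrix (Fin m) (Fin m) ℕ := Matrix.of fun i j => (ζ.word j).count i

/-- `ζ` is primitive: some power of the substitution matrix has only positive entries. -/
def IsPrimitive : Prop := (ζ.matrix.map (Nat.cast : ℕ → ℝ)).IsPrimitive

/-- `L` lists all the complex eigenvalues of the substitution matrix, each one repeated
according to its algebraic multiplicity, in the order of non-increasing modulus. -/
def IsEigenvalueList (L : List ℂ) : Prop :=
  (L : Multiset ℂ) = (ζ.matrix.map (Nat.cast : ℕ → ℂ)).charpoly.roots ∧
    L.Pairwise fun z w => ‖w‖ ≤ ‖z‖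

end Substitution

/-- The block `x_i x_{i+1} … x_{i+n-1}` of a two-sided sequence. -/
def block {m : ℕ} (x : ℤ → Fin m) (i : ℤ) (n : ℕ) : List (Fin m) :=
  (List.range n).map fun k : ℕ => x (i + k)

/-- The substitution space: all two-sided sequences `x` such that every block `x[-n,n]` is a
subword of some `ζ^k(a)`. It carries the Borel (product) sigma-algebra of `ℤ → Fin m`. -/
def Space {m : ℕ} (ζ : Substitution m) : Set (ℤ → Fin m) :=
  {x | ∀ n : ℕ, ∃ (k : ℕ) (a : Fin m), block x (-n) (2 * n + 1) <:+: ζ.iter k a}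

theorem block_infix {m : ℕ} (x : ℤ → Fin m) (i : ℤ) (p n q : ℕ) :
    block x (i + p) n <:+: block x i (p + n + q) := by
  refine ⟨block x i p, block x (i + p + n) q, ?_⟩
  simp only [block, List.range_add, List.map_append, List.map_map]
  congr 2
  · apply List.map_congr_left
    intro k _
    simp [add_assoc]
  · funext k
    simp [add_assoc]

theorem shift_mem {m : ℕ} (ζ : Substitution m) (n : ℤ) {x : ℤ → Fin m} (hx : x ∈ Space ζ) :
    (fun j => x (j + n)) ∈ Space ζ := by
  intro N
  obtain ⟨k, a, h⟩ := hx (N + n.natAbs)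
  refine ⟨k, a, List.IsInfix.trans ?_ h⟩
  obtain ⟨p, hp⟩ : ∃ p : ℕ, (p : ℤ) = n.natAbs + n := ⟨(n.natAbs + n).toNat, by omega⟩
  obtain ⟨q, hq⟩ : ∃ q : ℕ, (q : ℤ) = n.natAbs - n := ⟨(n.natAbs - n).toNat, by omega⟩
  have h1 : block (fun j => x (j + n)) (-N) (2 * N + 1)
      = block x (-((N + n.natAbs : ℕ) : ℤ) + p) (2 * N + 1) := by
    apply List.map_congr_left
    intro k _
    have : (-(N : ℤ) + k + n) = -((N + n.natAbs : ℕ) : ℤ) + p + k := by omega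
    simp only [this]
  have h2 : 2 * (N + n.natAbs) + 1 = p + (2 * N + 1) + q := by omega
  rw [h1, h2]
  exact block_infix x _ p _ q

/-- The `n`-th power (`n ∈ ℤ`) of the left shift, on the substitution space. -/
def shift {m : ℕ} (ζ : Substitution m) (n : ℤ) (x : Space ζ) : Space ζ :=
  ⟨fun j => x.1 (j + n), shift_mem ζ n x.2⟩

/-- The simplex of roof vectors: strictly positive vectors with sum one. -/
def roofSimplex (m : ℕ) : Set (Fin m → ℝ) := {s | (∀ a, 0 < s a) ∧ ∑ a, s a = 1}

/-- The height at which the `n`-th letter of `x` starts: `s_{x_0} + … + s_{x_{n-1}}` for `n ≥ 0`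
and `-(s_{x_n} + … + s_{x_{-1}})` for `n < 0`. -/
def roofSum {m : ℕ} (s : Fin m → ℝ) (x : ℤ → Fin m) (n : ℤ) : ℝ :=
  ∑ j ∈ Finset.Ico 0 n, s (x j) - ∑ j ∈ Finset.Ico n 0, s (x j)

theorem roofSum_succ {m : ℕ} (s : Fin m → ℝ) (x : ℤ → Fin m) (n : ℤ) :
    roofSum s x (n + 1) = roofSum s x n + s (x n) := by
  unfold roofSum
  rcases le_or_gt 0 n with h | h
  · have e : Finset.Ico 0 (n + 1) = insert n (Finset.Ico 0 n) := by
      ext j; simp only [Finset.mem_Ico, Finset.mem_insert]; omega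
    rw [e, Finset.sum_insert (by simp), Finset.Ico_eq_empty_of_le h,
      Finset.Ico_eq_empty_of_le (by omega : (0 : ℤ) ≤ n + 1)]
    simp [add_comm]
  · have e : Finset.Ico n 0 = insert n (Finset.Ico (n + 1) 0) := by
      ext j; simp only [Finset.mem_Ico, Finset.mem_insert]; omega
    rw [e, Finset.sum_insert (by simp), Finset.Ico_eq_empty_of_le h.le,
      Finset.Ico_eq_empty_of_le (by omega : n + 1 ≤ (0 : ℤ))]
    simp

theorem exists_roofIndex {m : ℕ} {s : Fin m → ℝ} (hs : ∀ a, 0 < s a) (x : ℤ → Fin m) (u : ℝ) :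
    ∃ n : ℤ, roofSum s x n ≤ u ∧ u < roofSum s x (n + 1) := by
  obtain ⟨a₀, -, h₀⟩ := Finset.exists_min_image Finset.univ s ⟨x 0, Finset.mem_univ _⟩
  set c := s a₀ with hc
  have hcpos : 0 < c := hs a₀
  have hmin : ∀ a, c ≤ s a := fun a => h₀ a (Finset.mem_univ a)
  have hup : ∀ k : ℕ, (k : ℝ) * c ≤ roofSum s x k := by
    intro k
    induction k with
    | zero => simp [roofSum]
    | succ k ih =>
      push_cast
      rw [roofSum_succ]
      nlinarith [hmin (x k)]
  have hdn : ∀ k : ℕ, roofSum s x (-k) ≤ -((k : ℝ) * c) := by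
    intro k
    induction k with
    | zero => simp [roofSum]
    | succ k ih =>
      have := roofSum_succ s x (-((k + 1 : ℕ) : ℤ))
      rw [show (-((k + 1 : ℕ) : ℤ) + 1) = -(k : ℤ) by push_cast; ring] at this
      push_cast at this ⊢
      nlinarith [hmin (x (-(k + 1 : ℤ)))]
  have hmono : Monotone (roofSum s x) :=
    monotone_int_of_le_succ fun n => by rw [roofSum_succ]; linarith [hs (x n)]
  obtain ⟨k, hk⟩ := exists_nat_gt (|u| / c)
  rw [div_lt_iff₀ hcpos] at hk
  obtain ⟨n, hn, hmax⟩ := Int.exists_greatest_of_bdd (P := fun n => roofSum s x n ≤ u)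
    ⟨k, fun z hz => by
      by_contra! hlt
      have := hmono hlt.le
      linarith [hup k, le_abs_self u]⟩
    ⟨-k, by linarith [hdn k, neg_abs_le u]⟩
  refine ⟨n, hn, ?_⟩
  by_contra! h
  have := hmax (n + 1) h
  omega

/-- The index of the letter of `x` over which the height `u` lies. -/
def roofIndex {m : ℕ} {s : Fin m → ℝ} (hs : ∀ a, 0 < s a) (x : ℤ → Fin m) (u : ℝ) : ℤ :=
  (exists_roofIndex hs x u).choose

theorem roofIndex_spec {m : ℕ} {s : Fin m → ℝ} (hs : ∀ a, 0 < s a) (x : ℤ → Fin m) (u : ℝ) :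
    roofSum s x (roofIndex hs x u) ≤ u ∧ u < roofSum s x (roofIndex hs x u + 1) :=
  (exists_roofIndex hs x u).choose_spec

/-- The points of the suspension: pairs `(x, t)` with `x` in the substitution space and
`0 ≤ t < s_{x_0}` (the top `(x, s_{x_0})` is identified with `(T x, 0)`). -/
def suspension {m : ℕ} (ζ : Substitution m) (s : Fin m → ℝ) : Set (Space ζ × ℝ) :=
  {p | 0 ≤ p.2 ∧ p.2 < s (p.1.1 0)}

/-- The suspension flow: move up with unit speed. From `(x, t)` one reaches at time `τ` the
height `t + τ`, which lies over the `n`-th letter of `x`, that is, the point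
`(T^n x, t + τ - roofSum s x n)`. -/
def flow {m : ℕ} (ζ : Substitution m) {s : Fin m → ℝ} (hs : ∀ a, 0 < s a) (τ : ℝ)
    (y : suspension ζ s) : suspension ζ s :=
  ⟨(shift ζ (roofIndex hs y.1.1.1 (y.1.2 + τ)) y.1.1,
      y.1.2 + τ - roofSum s y.1.1.1 (roofIndex hs y.1.1.1 (y.1.2 + τ))), by
    have h := roofIndex_spec hs y.1.1.1 (y.1.2 + τ)
    rw [roofSum_succ] at h
    refine ⟨by simpa using h.1, ?_⟩
    simp only [shift, zero_add]
    linarith [h.2]⟩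

/-- The restriction of `μ × Lebesgue` to the suspension. -/
def suspMeasure₀ {m : ℕ} (ζ : Substitution m) (s : Fin m → ℝ) (μ : Measure (Space ζ)) :
    Measure (suspension ζ s) :=
  (μ.prod volume).comap Subtype.val

/-- The invariant probability measure of the suspension flow induced by `μ`: the restriction of
`μ × Lebesgue` to the suspension, normalized. -/
def suspMeasure {m : ℕ} (ζ : Substitution m) (s : Fin m → ℝ) (μ : Measure (Space ζ)) :
    Measure (suspension ζ s) :=
  (suspMeasure₀ ζ s μ Set.univ)⁻¹ • suspMeasure₀ ζ s μ

/-- The cylindrical function `f(x, t) = ψ_{x_0}(t)` on the suspension. -/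
def cylindrical {m : ℕ} (ζ : Substitution m) (s : Fin m → ℝ) (ψ : Fin m → ℝ → ℂ) :
    suspension ζ s → ℂ :=
  fun y => ψ (y.1.1.1 0) y.1.2

/-- `σ` is the spectral measure of `f` for the flow `h` and the invariant measure `ν`: the finite
Borel measure on the line with `∫ e^{2πiωt} dσ(ω) = ⟨f ∘ h_t, f⟩` for all real `t`. -/
def IsSpectralMeasure {Y : Type*} [MeasurableSpace Y] (ν : Measure Y) (h : ℝ → Y → Y) (f : Y → ℂ)
    (σ : Measure ℝ) : Prop :=
  IsFiniteMeasure σ ∧ ∀ t : ℝ,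
    ∫ ω : ℝ, Complex.exp (2 * Real.pi * Complex.I * ω * t) ∂σ
      = ∫ y, f (h t y) * (starRingEnd ℂ) (f y) ∂ν

end SubstFlow

end

open Polynomial Matrix

namespace SubstFlow

/-! ### Growth of linear recurrence sequences -/

/-! Integrating the correlation identity over `[0,R]²` turns it into `∫ |∫₀^R e^{2πiωt} dt|² dσ(ω) =
∫ |∫₀^R f ∘ h_t dt|²`, the right side taken over the suspension. For `R = 1/(2πr)` the exponential
integral is at least `R/2` in modulus when `|ω| ≤ r`, so `σ([-r,r])` is at most `4/R²` times the
square of any uniform bound on ergodic integrals (`spectral_mass_le`). It remains to bound those of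
length `R` by `O(‖f‖ (log R)^α R^β)`.

Up to two boundary terms, an ergodic integral is the sum along a word of the language of the vector
`v` of letter integrals (`exists_word_norm_integral_fibre_le`). Mean zero says that `v` annihilates
the letter frequencies, which form the right Perron vector `h`
(`dotProduct_eq_zero_of_integral_eq_zero`). A word of length at most `θ^j` is desubstituted `j`
times. Level `i` leaves two end words of bounded length weighted by `v S^i`, and a core of bounded
length survives. If `v S^i = O(i^α |θ₂|^i)`, the assumption `|θ₂| > 1` makes the total `O(j^α
|θ₂|^j)` (`exists_wordSum_pow_bound`).

The growth of `v S^i` needs no Jordan form. On the annihilator of `h` the root `θ₁` drops out of the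
characteristic polynomial, and the remaining scalar recurrence is solved one root at a time
(`exists_bound_of_recurrence`): the first root on the circle of radius `|θ₂|` costs no power of `i`,
each of the other `α` costs one. The same recurrence bound, applied to the whole matrix, provides
the growth estimate behind the Perron–Frobenius facts used here. -/

theorem exists_bound_of_step_lt {u : ℕ → ℂ} {z : ℂ} {r C : ℝ} (hz : ‖z‖ < r)
    (h : ∀ n, ‖u (n + 1) - z * u n‖ ≤ C * r ^ n) : ∃ C', ∀ n, ‖u n‖ ≤ C' * r ^ n := by
  have hr : 0 < r := (norm_nonneg z).trans_lt hz
  refine ⟨max ‖u 0‖ (C / (r - ‖z‖)), fun n => ?_⟩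
  set K := max ‖u 0‖ (C / (r - ‖z‖)) with hK
  have hCK : C ≤ K * (r - ‖z‖) := by
    rw [← div_le_iff₀ (by linarith)]; exact le_max_right _ _
  induction n with
  | zero => simp [hK]
  | succ n ih =>
    have h1 : ‖u (n + 1)‖ ≤ ‖u (n + 1) - z * u n‖ + ‖z‖ * ‖u n‖ := by
      rw [← norm_mul]; simpa using norm_add_le (u (n + 1) - z * u n) (z * u n)
    have h2 : ‖z‖ * ‖u n‖ ≤ ‖z‖ * (K * r ^ n) := by gcongr
    have h3 : C * r ^ n ≤ K * (r - ‖z‖) * r ^ n := by gcongr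
    calc ‖u (n + 1)‖ ≤ K * (r - ‖z‖) * r ^ n + ‖z‖ * (K * r ^ n) := by linarith [h n]
      _ = K * r ^ (n + 1) := by ring

/-- Relative to `‖z‖ ^ n` the forcing term is summable, so a root outside the forcing radius
produces no polynomial factor. -/
theorem exists_bound_of_step_gt {u : ℕ → ℂ} {z : ℂ} {r C : ℝ} (hr : 0 < r) (hz : r < ‖z‖)
    (h : ∀ n, ‖u (n + 1) - z * u n‖ ≤ C * r ^ n) : ∃ C', ∀ n, ‖u n‖ ≤ C' * ‖z‖ ^ n := by
  have hC : 0 ≤ C := by simpa using (norm_nonneg _).trans (h 0)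
  set K := C / (‖z‖ - r) with hK
  have hCK : C = K * (‖z‖ - r) := by rw [hK, div_mul_cancel₀]; linarith
  have hK0 : 0 ≤ K := div_nonneg hC (by linarith)
  -- Subtracting `K * r ^ n`, which solves the comparison recursion exactly, strengthens the claim
  -- enough for the induction to close.
  have key : ∀ n, ‖u n‖ ≤ (‖u 0‖ + K) * ‖z‖ ^ n - K * r ^ n := by
    intro n
    induction n with
    | zero => simp
    | succ n ih =>
      have h1 : ‖u (n + 1)‖ ≤ ‖u (n + 1) - z * u n‖ + ‖z‖ * ‖u n‖ := by
        rw [← norm_mul]; simpa using norm_add_le (u (n + 1) - z * u n) (z * u n)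
      have h2 : ‖z‖ * ‖u n‖ ≤ ‖z‖ * ((‖u 0‖ + K) * ‖z‖ ^ n - K * r ^ n) := by gcongr
      calc ‖u (n + 1)‖ ≤ K * (‖z‖ - r) * r ^ n + ‖z‖ * ((‖u 0‖ + K) * ‖z‖ ^ n - K * r ^ n) := by
            rw [← hCK]; linarith [h n]
        _ = _ := by ring
  refine ⟨‖u 0‖ + K, fun n => (key n).trans ?_⟩
  have : 0 ≤ K * r ^ n := by positivity
  linarith

/-- The resonant case: forcing and homogeneous solution grow at the same exponential rate, and
summing `n` comparable terms costs one power of `n`. -/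
theorem exists_bound_of_step_eq {u : ℕ → ℂ} {z : ℂ} {R C : ℝ} {j : ℕ} (hR : 0 < R) (hz : ‖z‖ = R)
    (h : ∀ n : ℕ, ‖u (n + 1) - z * u n‖ ≤ C * (n + 1) ^ j * R ^ n) :
    ∃ C', ∀ n : ℕ, ‖u n‖ ≤ C' * (n + 1) ^ (j + 1) * R ^ n := by
  refine ⟨max ‖u 0‖ (C / R), fun n => ?_⟩
  set K := max ‖u 0‖ (C / R) with hK
  have hK0 : 0 ≤ K := (norm_nonneg _).trans (le_max_left _ _)
  have hCK : C ≤ K * R := by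
    rw [← div_le_iff₀ hR]; exact le_max_right _ _
  induction n with
  | zero => simp [hK]
  | succ n ih =>
    have h1 : ‖u (n + 1)‖ ≤ ‖u (n + 1) - z * u n‖ + ‖z‖ * ‖u n‖ := by
      rw [← norm_mul]; simpa using norm_add_le (u (n + 1) - z * u n) (z * u n)
    have h2 : ‖z‖ * ‖u n‖ ≤ R * (K * (n + 1) ^ (j + 1) * R ^ n) := by rw [hz]; gcongr
    have h3 : C * (n + 1 : ℝ) ^ j * R ^ n ≤ K * R * (n + 1) ^ j * R ^ n := by gcongr
    have h4 : ((n : ℝ) + 1) ^ j * (n + 2) ≤ (n + 2) ^ (j + 1) := by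
      rw [pow_succ]; gcongr; norm_num
    calc ‖u (n + 1)‖ ≤ K * R * (n + 1) ^ j * R ^ n + R * (K * (n + 1) ^ (j + 1) * R ^ n) := by
          linarith [h n]
      _ = K * ((n + 1) ^ j * (n + 2)) * R ^ (n + 1) := by ring
      _ ≤ K * (n + 2) ^ (j + 1) * R ^ (n + 1) := by gcongr
      _ = K * ((n + 1 : ℕ) + 1) ^ (j + 1) * R ^ (n + 1) := by push_cast; ring

/-- For `u n = Φ (X ^ n * p)`, multiplying `p` by `X - C z` amounts to forming `u (n + 1) - z * u
n`. Factoring the characteristic polynomial thus splits a recurrence into first-order ones. -/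
theorem map_X_pow_mul_linear_mul (Φ : ℂ[X] →ₗ[ℂ] ℂ) (z : ℂ) (p : ℂ[X]) (n : ℕ) :
    Φ (X ^ n * ((X - C z) * p)) = Φ (X ^ (n + 1) * p) - z * Φ (X ^ n * p) := by
  have : X ^ n * ((X - C z) * p) = X ^ (n + 1) * p - z • (X ^ n * p) := by
    rw [smul_eq_C_mul]; ring
  rw [this, map_sub, map_smul, smul_eq_mul]

theorem exists_bound_of_roots_lt (Φ : ℂ[X] →ₗ[ℂ] ℂ) {R : ℝ} (s : Multiset ℂ) :
    ∀ p : ℂ[X], (∀ z ∈ s, ‖z‖ < R) →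
      (∃ r, 0 < r ∧ r < R ∧ ∃ K, ∀ n : ℕ,
        ‖Φ (X ^ n * ((s.map fun z => X - C z).prod * p))‖ ≤ K * r ^ n) →
      ∃ r, 0 < r ∧ r < R ∧ ∃ K, ∀ n : ℕ, ‖Φ (X ^ n * p)‖ ≤ K * r ^ n := by
  induction s using Multiset.induction with
  | empty => intro p _ h; simpa using h
  | cons z s ih =>
    intro p hs h
    obtain ⟨r, hr0, hrR, K, hK⟩ := ih ((X - C z) * p) (fun w hw => hs w (by simp [hw])) (by
      simpa [mul_assoc, mul_left_comm] using h)
    have hzR := hs z (by simp)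
    have hK0 : 0 ≤ K := by simpa using (norm_nonneg _).trans (hK 0)
    have hle : r ≤ max r ((‖z‖ + R) / 2) := le_max_left _ _
    -- The new radius must exceed `‖z‖` strictly, to avoid resonance, and stay below `R`.
    refine ⟨max r ((‖z‖ + R) / 2), lt_of_lt_of_le hr0 hle, max_lt hrR (by linarith), ?_⟩
    refine exists_bound_of_step_lt (z := z) (C := K)
      (lt_of_lt_of_le (by linarith) (le_max_right _ _)) fun n => ?_
    rw [← map_X_pow_mul_linear_mul]
    exact (hK n).trans (by gcongr)

theorem exists_bound_of_roots_eq (Φ : ℂ[X] →ₗ[ℂ] ℂ) {R : ℝ} (hR : 0 < R) (s : Multiset ℂ) :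
    ∀ p : ℂ[X], (∀ z ∈ s, ‖z‖ = R) →
      (∃ K, ∀ n : ℕ, ‖Φ (X ^ n * ((s.map fun z => X - C z).prod * p))‖ ≤ K * R ^ n) →
      ∃ K, ∀ n : ℕ, ‖Φ (X ^ n * p)‖ ≤ K * (n + 1) ^ s.card * R ^ n := by
  induction s using Multiset.induction with
  | empty => intro p _ h; simpa using h
  | cons z s ih =>
    intro p hs h
    obtain ⟨K, hK⟩ := ih ((X - C z) * p) (fun w hw => hs w (by simp [hw])) (by
      simpa [mul_assoc, mul_left_comm] using h)
    rw [Multiset.card_cons]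
    refine exists_bound_of_step_eq (z := z) (C := K) hR (hs z (by simp)) fun n => ?_
    rw [← map_X_pow_mul_linear_mul]
    exact hK n

/-- A linear recurrence whose characteristic roots have modulus at most `R`, with `d + 1` of them
on the circle of radius `R`, has solutions of size `O(n ^ d * R ^ n)`. -/
theorem exists_bound_of_recurrence (Φ : ℂ[X] →ₗ[ℂ] ℂ) {R : ℝ} (hR : 0 < R) (s : Multiset ℂ)
    (hs : ∀ z ∈ s, ‖z‖ ≤ R) {d : ℕ} (hd : s.countP (fun z => ‖z‖ = R) = d + 1)
    (h : ∀ n : ℕ, Φ (X ^ n * (s.map fun z => X - C z).prod) = 0) :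
    ∃ K, ∀ n : ℕ, ‖Φ (X ^ n)‖ ≤ K * (n + 1) ^ d * R ^ n := by
  set t := s.filter fun z => ‖z‖ = R
  set l := s.filter fun z => ¬ ‖z‖ = R
  have hst : s = l + t := by rw [add_comm]; exact (Multiset.filter_add_not _ s).symm
  have hcard : t.card = d + 1 := by rw [← hd, Multiset.countP_eq_card_filter]
  -- One root on the circle is set aside: it is treated right after the inner roots, while the
  -- forcing is still `O(r ^ n)` with `r < R`, and so costs no power of `n`. This yields `d` rather
  -- than `d + 1`.
  obtain ⟨z, hz⟩ := Multiset.card_pos_iff_exists_mem.mp (by omega : 0 < t.card)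
  obtain ⟨t', ht'⟩ := Multiset.exists_cons_of_mem hz
  have htR : ∀ w ∈ t, ‖w‖ = R := fun w hw => (Multiset.mem_filter.mp hw).2
  have hlR : ∀ w ∈ l, ‖w‖ < R := fun w hw =>
    lt_of_le_of_ne (hs w (Multiset.mem_filter.mp hw).1) (Multiset.mem_filter.mp hw).2
  have hprod : (s.map fun z => X - C z).prod = (l.map fun z => X - C z).prod *
      ((X - C z) * (t'.map fun z => X - C z).prod) := by
    rw [hst, ht']; simp only [Multiset.map_add, Multiset.map_cons, Multiset.prod_add, Multiset.prod_cons]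
  obtain ⟨r, hr0, hrR, K, hK⟩ := exists_bound_of_roots_lt Φ l
    ((X - C z) * (t'.map fun z => X - C z).prod) hlR
    ⟨R / 2, by linarith, by linarith, 0, fun n => by rw [← hprod, h n]; simp⟩
  have hzR := htR z hz
  obtain ⟨K', hK'⟩ := exists_bound_of_step_gt (z := z) (C := K)
    (u := fun n => Φ (X ^ n * (t'.map fun z => X - C z).prod)) hr0 (by rw [hzR]; exact hrR)
    fun n => by rw [← map_X_pow_mul_linear_mul]; exact hK n
  have := exists_bound_of_roots_eq Φ hR t' 1
    (fun w hw => htR w (by rw [ht']; exact Multiset.mem_cons_of_mem hw))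
    ⟨K', fun n => by rw [mul_one, ← hzR]; exact hK' n⟩
  have hc : t'.card = d := by rw [ht', Multiset.card_cons] at hcard; omega
  simpa [hc] using this

/-! ### Perron–Frobenius theory of primitive matrices -/

section Perron

variable {m : ℕ} {B : Matrix (Fin m) (Fin m) ℝ} {ρ : ℝ}

theorem primitive_transpose (hB : B.IsPrimitive) : Bᵀ.IsPrimitive := by
  obtain ⟨hn, k, hk, hpos⟩ := hB
  refine ⟨fun i j => hn j i, k, hk, fun i j => ?_⟩
  rw [← Matrix.transpose_pow]
  exact hpos j i

theorem pow_mulVec_eigen {R : Type*} [CommRing R] {A : Matrix (Fin m) (Fin m) R} {x : Fin m → R}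
    {z : R} (h : A *ᵥ x = z • x) (n : ℕ) : (A ^ n) *ᵥ x = z ^ n • x := by
  induction n with
  | zero => simp
  | succ n ih =>
    rw [pow_succ, ← Matrix.mulVec_mulVec, h, Matrix.mulVec_smul, ih, smul_smul, mul_comm, ← pow_succ]

/-- The powers of a matrix whose eigenvalues have modulus at most `ρ` grow at most like
`n ^ d * ρ ^ n`. -/
theorem exists_pow_bound {A : Matrix (Fin m) (Fin m) ℂ} (hρ : 0 < ρ)
    (hroots : ∀ z ∈ A.charpoly.roots, ‖z‖ ≤ ρ) (hex : ∃ z ∈ A.charpoly.roots, ‖z‖ = ρ) :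
    ∃ (d : ℕ) (K : ℝ), ∀ (n : ℕ) i j, ‖(A ^ n) i j‖ ≤ K * (n + 1) ^ d * ρ ^ n := by
  have hpos : 0 < A.charpoly.roots.countP (fun z => ‖z‖ = ρ) := Multiset.countP_pos.mpr hex
  obtain ⟨d, hd⟩ := Nat.exists_eq_succ_of_ne_zero hpos.ne'
  have hprod : (A.charpoly.roots.map fun z => X - C z).prod = A.charpoly :=
    (Polynomial.Splits.eq_prod_roots_of_monic (IsAlgClosed.splits _) A.charpoly_monic).symm
  have key : ∀ i j, ∃ K, ∀ n : ℕ, ‖(A ^ n) i j‖ ≤ K * (n + 1) ^ d * ρ ^ n := by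
    intro i j
    let Φ : ℂ[X] →ₗ[ℂ] ℂ := (Matrix.entryLinearMap ℂ ℂ i j).comp (aeval A).toLinearMap
    have := exists_bound_of_recurrence Φ hρ _ hroots hd fun n => by
      rw [hprod]; simp [Φ, Matrix.aeval_self_charpoly]
    simpa [Φ] using this
  choose K hK using key
  refine ⟨d, ∑ i, ∑ j, |K i j|, fun n i j => (hK i j n).trans ?_⟩
  gcongr
  calc K i j ≤ |K i j| := le_abs_self _
    _ ≤ ∑ j, |K i j| := Finset.single_le_sum (f := fun j => |K i j|) (fun _ _ => abs_nonneg _) (Finset.mem_univ j)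
    _ ≤ _ := Finset.single_le_sum (f := fun i => ∑ j, |K i j|)
      (fun _ _ => Finset.sum_nonneg fun _ _ => abs_nonneg _) (Finset.mem_univ i)

theorem mulVec_pos_of_pos {B : Matrix (Fin m) (Fin m) ℝ} (hB : ∀ i j, 0 < B i j) {z : Fin m → ℝ}
    (hz : ∀ i, 0 ≤ z i) (hz0 : z ≠ 0) (i : Fin m) : 0 < (B *ᵥ z) i := by
  obtain ⟨j, hj⟩ := Function.ne_iff.mp hz0
  exact Finset.sum_pos' (fun k _ => mul_nonneg (hB i k).le (hz k))
    ⟨j, Finset.mem_univ j, mul_pos (hB i j) (lt_of_le_of_ne (hz j) (Ne.symm hj))⟩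

theorem mulVec_mono {B : Matrix (Fin m) (Fin m) ℝ} (hB : ∀ i j, 0 ≤ B i j) {y z : Fin m → ℝ}
    (h : ∀ i, y i ≤ z i) (i : Fin m) : (B *ᵥ y) i ≤ (B *ᵥ z) i := by
  simp only [Matrix.mulVec, dotProduct]
  exact Finset.sum_le_sum fun k _ => mul_le_mul_of_nonneg_left (h k) (hB i k)

/-- The source of contradictions in two places: for the rigidity of superinvariant vectors and for
the vanishing of means. -/
theorem not_forall_pow_le {a b c K : ℝ} (d : ℕ) (ha : 0 < a) (hab : a < b) (hc : 0 < c) :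
    ¬ ∀ n : ℕ, b ^ n * c ≤ K * (n + 1) ^ d * a ^ n := by
  intro h
  have hba : 1 < b / a := (one_lt_div ha).mpr hab
  have h1 := (tendsto_pow_const_div_const_pow_of_one_lt d hba).comp (Filter.tendsto_add_atTop_nat 1)
  have h2 := (h1.const_mul (K * (b / a)))
  rw [mul_zero] at h2
  obtain ⟨n, hn⟩ := (h2.eventually_lt_const hc).exists
  have hb : 0 < b := ha.trans hab
  have := h n
  have e : K * (b / a) * (((n + 1 : ℕ) : ℝ) ^ d / (b / a) ^ (n + 1))
      = (K * (n + 1) ^ d * a ^ n) / b ^ n := by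
    push_cast
    rw [pow_succ (b / a), div_pow]
    field_simp
  simp only [Function.comp] at hn
  rw [e, div_lt_iff₀ (by positivity)] at hn
  linarith

/-- A nonnegative vector with `ρ y ≤ B y`, where `B` is primitive and `ρ` bounds its growth, is a
positive eigenvector. -/
theorem eigen_of_superinvariant (hB : B.IsPrimitive) (hρ : 0 < ρ) {d : ℕ} {K : ℝ}
    (hgrow : ∀ (n : ℕ) i j, (B ^ n) i j ≤ K * (n + 1) ^ d * ρ ^ n)
    {y : Fin m → ℝ} (hy : ∀ i, 0 ≤ y i) (hy0 : y ≠ 0) (h : ∀ i, ρ * y i ≤ (B *ᵥ y) i) :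
    B *ᵥ y = ρ • y ∧ ∀ i, 0 < y i := by
  obtain ⟨hn, k, hk, hpos⟩ := hB
  have hyeq : B *ᵥ y = ρ • y := by
    by_contra hne
    -- A nonzero defect `z` becomes strictly positive under `B ^ k`. Hence `w = B ^ k y` satisfies
    -- `B w ≥ (ρ + ε) w` with `ε` the least ratio of `B ^ k z` to `w`, and iterating contradicts the
    -- growth bound at rate `ρ`.
    set z := B *ᵥ y - ρ • y with hzdef
    have hz : ∀ i, 0 ≤ z i := fun i => by simpa [hzdef] using h i
    have hz0 : z ≠ 0 := fun h0 => hne (sub_eq_zero.mp h0)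
    set w := (B ^ k) *ᵥ y with hw
    have hwpos : ∀ i, 0 < w i := mulVec_pos_of_pos hpos hy hy0
    have hzpos := mulVec_pos_of_pos hpos hz hz0
    have hBw : (B ^ k) *ᵥ z = B *ᵥ w - ρ • w := by
      rw [hzdef, Matrix.mulVec_sub, Matrix.mulVec_smul, Matrix.mulVec_mulVec, ← pow_succ, pow_succ',
        ← Matrix.mulVec_mulVec]
    obtain ⟨i₀, -⟩ := Function.ne_iff.mp hy0
    have : Nonempty (Fin m) := ⟨i₀⟩
    obtain ⟨i₁, hi₁⟩ := Finite.exists_min fun i => ((B ^ k) *ᵥ z) i / w i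
    set ε := ((B ^ k) *ᵥ z) i₁ / w i₁
    have hε : 0 < ε := div_pos (hzpos i₁) (hwpos i₁)
    have hstep : ∀ i, ((ρ + ε) • w) i ≤ (B *ᵥ w) i := fun i => by
      have h1 := hi₁ i
      rw [le_div_iff₀ (hwpos i), hBw] at h1
      simp only [Pi.sub_apply, Pi.smul_apply, smul_eq_mul] at h1 ⊢
      linarith
    have hiter : ∀ (n : ℕ) i, (ρ + ε) ^ n * w i ≤ ((B ^ n) *ᵥ w) i := by
      intro n
      induction n with
      | zero => simp
      | succ n ih =>
        intro i
        calc (ρ + ε) ^ (n + 1) * w i = (ρ + ε) ^ n * ((ρ + ε) • w) i := by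
              simp only [Pi.smul_apply, smul_eq_mul]; ring
          _ ≤ (ρ + ε) ^ n * (B *ᵥ w) i := by gcongr; exact hstep i
          _ = (B *ᵥ ((ρ + ε) ^ n • w)) i := by rw [Matrix.mulVec_smul]; rfl
          _ ≤ (B *ᵥ ((B ^ n) *ᵥ w)) i := mulVec_mono hn ih i
          _ = _ := by rw [Matrix.mulVec_mulVec, ← pow_succ']
    refine not_forall_pow_le (K := K * ∑ j, w j) d hρ (lt_add_of_pos_right ρ hε) (hwpos i₀) fun n => ?_
    calc (ρ + ε) ^ n * w i₀ ≤ ((B ^ n) *ᵥ w) i₀ := hiter n i₀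
      _ = ∑ j, (B ^ n) i₀ j * w j := rfl
      _ ≤ ∑ j, K * (n + 1) ^ d * ρ ^ n * w j :=
        Finset.sum_le_sum fun j _ => mul_le_mul_of_nonneg_right (hgrow n i₀ j) (hwpos j).le
      _ = _ := by rw [← Finset.mul_sum]; ring
  refine ⟨hyeq, fun i => ?_⟩
  have h1 := mulVec_pos_of_pos hpos hy hy0 i
  rw [pow_mulVec_eigen hyeq] at h1
  exact pos_of_mul_pos_right h1 (by positivity)

/-- Hypotheses identifying `ρ` as the spectral radius of `B`. -/
structure IsSpectralRadius (B : Matrix (Fin m) (Fin m) ℝ) (ρ : ℝ) : Prop where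
  pos : 0 < ρ
  le : ∀ z ∈ (B.map ((↑) : ℝ → ℂ)).charpoly.roots, ‖z‖ ≤ ρ
  exists_eq : ∃ z ∈ (B.map ((↑) : ℝ → ℂ)).charpoly.roots, ‖z‖ = ρ

theorem IsSpectralRadius.transpose (h : IsSpectralRadius B ρ) : IsSpectralRadius Bᵀ ρ := by
  have e : (Bᵀ.map ((↑) : ℝ → ℂ)).charpoly = (B.map ((↑) : ℝ → ℂ)).charpoly := by
    rw [Matrix.transpose_map, Matrix.charpoly_transpose]
  exact ⟨h.pos, e ▸ h.le, e ▸ h.exists_eq⟩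

theorem map_ofReal_pow (B : Matrix (Fin m) (Fin m) ℝ) (n : ℕ) :
    (B ^ n).map ((↑) : ℝ → ℂ) = (B.map ((↑) : ℝ → ℂ)) ^ n :=
  Matrix.map_pow B Complex.ofRealHom n

theorem map_ofReal_mulVec (B : Matrix (Fin m) (Fin m) ℝ) (y : Fin m → ℝ) (i : Fin m) :
    (B.map ((↑) : ℝ → ℂ) *ᵥ fun j => (y j : ℂ)) i = ((B *ᵥ y) i : ℝ) := by
  simp [Matrix.mulVec, dotProduct]

theorem IsSpectralRadius.eigen_of_superinvariant (h : IsSpectralRadius B ρ) (hB : B.IsPrimitive)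
    {y : Fin m → ℝ} (hy : ∀ i, 0 ≤ y i) (hy0 : y ≠ 0) (hle : ∀ i, ρ * y i ≤ (B *ᵥ y) i) :
    B *ᵥ y = ρ • y ∧ ∀ i, 0 < y i := by
  obtain ⟨d, K, hK⟩ := exists_pow_bound h.pos h.le h.exists_eq
  refine SubstFlow.eigen_of_superinvariant hB h.pos (d := d) (K := K) (fun n i j => ?_) hy hy0 hle
  have := hK n i j
  rw [← map_ofReal_pow, Matrix.map_apply, Complex.norm_real] at this
  exact (le_abs_self _).trans this

/-- The moduli of an eigenvector with an eigenvalue of modulus `ρ` form a positive eigenvector. -/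
theorem IsSpectralRadius.norm_eigen (h : IsSpectralRadius B ρ) (hB : B.IsPrimitive)
    {x : Fin m → ℂ} {z : ℂ} (hx0 : x ≠ 0) (hz : ‖z‖ = ρ)
    (hx : B.map ((↑) : ℝ → ℂ) *ᵥ x = z • x) :
    B *ᵥ (fun i => ‖x i‖) = ρ • (fun i => ‖x i‖) ∧ ∀ i, 0 < ‖x i‖ := by
  refine h.eigen_of_superinvariant hB (fun i => norm_nonneg _) (fun h0 => hx0 ?_) fun i => ?_
  · ext i; simpa using congrFun h0 i
  · have := congrFun hx i
    rw [← hz, ← norm_mul, ← smul_eq_mul, ← Pi.smul_apply, ← this]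
    simp only [Matrix.mulVec, dotProduct]
    refine (norm_sum_le _ _).trans (Finset.sum_le_sum fun j _ => ?_)
    have := hB.1 i j
    simp [abs_of_nonneg this]

theorem exists_unit_mul_eq_norm (z : ℂ) : ∃ c : ℂ, ‖c‖ = 1 ∧ c * z = ‖z‖ := by
  by_cases h : z = 0
  · exact ⟨1, by simp [h]⟩
  · have h' : (‖z‖ : ℂ) ≠ 0 := by simpa using h
    refine ⟨‖z‖ / z, by simp [h], by field_simp⟩

/-- An eigenvector whose eigenvalue has modulus `ρ` is a multiple of a positive vector. -/
theorem IsSpectralRadius.exists_smul_eq_norm (h : IsSpectralRadius B ρ) (hB : B.IsPrimitive)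
    {x : Fin m → ℂ} {z : ℂ} (hx0 : x ≠ 0) (hz : ‖z‖ = ρ)
    (hx : B.map ((↑) : ℝ → ℂ) *ᵥ x = z • x) :
    ∃ c : ℂ, ‖c‖ = 1 ∧ ∀ i, c * x i = ‖x i‖ := by
  obtain ⟨hh, hpos⟩ := h.norm_eigen hB hx0 hz hx
  obtain ⟨hn, k, hk, hkpos⟩ := hB
  obtain ⟨i₀, -⟩ := Function.ne_iff.mp hx0
  obtain ⟨c, hc1, hc⟩ := exists_unit_mul_eq_norm (z ^ k * x i₀)
  refine ⟨c, hc1, ?_⟩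
  -- `g` is the nonnegative defect in the triangle inequality after rotating by `c`. By the choice
  -- of `c` the vector `B ^ k g` vanishes at `i₀`, and strict positivity of `B ^ k` then forces `g =
  -- 0`.
  set g : Fin m → ℝ := fun i => ‖x i‖ - (c * x i).re with hg
  have hg0 : ∀ i, 0 ≤ g i := fun i => by
    have := Complex.re_le_norm (c * x i)
    rw [norm_mul, hc1, one_mul] at this
    simpa [hg] using this
  have hsum : ((B ^ k) *ᵥ g) i₀ = 0 := by
    have h1 : ((B ^ k) *ᵥ fun i => ‖x i‖) i₀ = ρ ^ k * ‖x i₀‖ := by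
      rw [pow_mulVec_eigen hh]; rfl
    have h2 : ((B ^ k) *ᵥ fun i => (c * x i).re) i₀ = (c * (z ^ k * x i₀)).re := by
      have := congrFun (pow_mulVec_eigen hx k) i₀
      rw [← map_ofReal_pow] at this
      rw [← smul_eq_mul (z ^ k), ← Pi.smul_apply, ← this]
      simp only [Matrix.mulVec, dotProduct, Matrix.map_apply, Finset.mul_sum, Complex.re_sum]
      refine Finset.sum_congr rfl fun j _ => ?_
      rw [mul_left_comm, Complex.re_ofReal_mul]
    have : g = (fun i => ‖x i‖) - fun i => (c * x i).re := rfl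
    rw [this, Matrix.mulVec_sub, Pi.sub_apply, h1, h2, hc, Complex.ofReal_re, norm_mul, norm_pow, hz,
      sub_self]
  have hgz : g = 0 := by
    by_contra hne
    exact (mulVec_pos_of_pos hkpos hg0 hne i₀).ne' hsum
  intro i
  have h1 : (c * x i).re = ‖c * x i‖ := by
    have := congrFun hgz i
    simp only [hg, Pi.zero_apply] at this
    rw [norm_mul, hc1, one_mul]; linarith
  rw [Complex.re_eq_norm] at h1
  have h2 := Complex.norm_of_nonneg' h1
  rw [norm_mul, hc1, one_mul] at h2
  exact h2.symm

theorem exists_eigenvector_of_mem_roots {A : Matrix (Fin m) (Fin m) ℂ} {z : ℂ}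
    (hz : z ∈ A.charpoly.roots) : ∃ x ≠ 0, A *ᵥ x = z • x := by
  have hz' : A.charpoly.IsRoot z := (Polynomial.mem_roots'.mp hz).2
  rw [Polynomial.IsRoot, Matrix.eval_charpoly] at hz'
  obtain ⟨x, hx0, hx⟩ := Matrix.exists_mulVec_eq_zero_iff.mpr hz'
  refine ⟨x, hx0, ?_⟩
  rw [Matrix.sub_mulVec, sub_eq_zero] at hx
  rw [← hx]; simp [Matrix.scalar_apply]

/-- After rotation the eigenvector is its own vector of moduli, which is an eigenvector for both `z`
and `ρ`. -/
theorem IsSpectralRadius.eq_of_norm_eq (h : IsSpectralRadius B ρ) (hB : B.IsPrimitive)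
    {z : ℂ} (hzr : z ∈ (B.map ((↑) : ℝ → ℂ)).charpoly.roots) (hz : ‖z‖ = ρ) : z = ρ := by
  obtain ⟨x, hx0, hx⟩ := exists_eigenvector_of_mem_roots hzr
  obtain ⟨c, hc1, hc⟩ := h.exists_smul_eq_norm hB hx0 hz hx
  obtain ⟨hh, hpos⟩ := h.norm_eigen hB hx0 hz hx
  obtain ⟨i₀, hi⟩ := Function.ne_iff.mp hx0
  have h1 : (B.map ((↑) : ℝ → ℂ) *ᵥ fun j => ((‖x j‖ : ℝ) : ℂ)) i₀ = z * ‖x i₀‖ := by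
    have : (fun j => ((‖x j‖ : ℝ) : ℂ)) = c • x := by ext j; simp [hc]
    rw [this, Matrix.mulVec_smul, hx, ← hc i₀]
    simp only [Pi.smul_apply, smul_eq_mul]; ring
  rw [map_ofReal_mulVec, hh] at h1
  have h2 : (‖x i₀‖ : ℂ) ≠ 0 := by simpa using hi
  simp only [Pi.smul_apply, smul_eq_mul, Complex.ofReal_mul] at h1
  exact (mul_right_cancel₀ h2 h1).symm

theorem IsSpectralRadius.exists_pos_eigen (h : IsSpectralRadius B ρ) (hB : B.IsPrimitive) :
    ∃ y : Fin m → ℝ, (∀ i, 0 < y i) ∧ B *ᵥ y = ρ • y := by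
  obtain ⟨z, hzr, hz⟩ := h.exists_eq
  obtain ⟨x, hx0, hx⟩ := exists_eigenvector_of_mem_roots hzr
  obtain ⟨hh, hpos⟩ := h.norm_eigen hB hx0 hz hx
  exact ⟨_, hpos, hh⟩

/-- Rotate `x` to its vector of moduli and subtract the largest multiple of `y` that keeps it
nonnegative. The difference is a nonnegative eigenvector with a zero entry, so it vanishes, since a
nonzero one would be strictly positive. -/
theorem IsSpectralRadius.eigen_unique (h : IsSpectralRadius B ρ) (hB : B.IsPrimitive)
    {y : Fin m → ℝ} (hy : ∀ i, 0 < y i) (hye : B *ᵥ y = ρ • y) {x : Fin m → ℂ}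
    (hx : B.map ((↑) : ℝ → ℂ) *ᵥ x = (ρ : ℂ) • x) : ∃ c : ℂ, ∀ i, x i = c * y i := by
  by_cases hx0 : x = 0
  · exact ⟨0, by simp [hx0]⟩
  have hz : ‖(ρ : ℂ)‖ = ρ := by simp [abs_of_pos h.pos]
  obtain ⟨c, hc1, hc⟩ := h.exists_smul_eq_norm hB hx0 hz hx
  obtain ⟨hh, hpos⟩ := h.norm_eigen hB hx0 hz hx
  obtain ⟨i₀, hi⟩ := Function.ne_iff.mp hx0
  have : Nonempty (Fin m) := ⟨i₀⟩
  obtain ⟨i₁, hi₁⟩ := Finite.exists_min fun i => ‖x i‖ / y i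
  set t := ‖x i₁‖ / y i₁ with ht
  have hw : (fun i => ‖x i‖) - t • y = 0 := by
    by_contra hne
    have := (h.eigen_of_superinvariant hB (y := (fun i => ‖x i‖) - t • y) (fun i => by
      have := hi₁ i
      rw [le_div_iff₀ (hy i)] at this
      simpa using this) hne (fun i => by
        rw [Matrix.mulVec_sub, Matrix.mulVec_smul, hh, hye]
        simp only [Pi.sub_apply, Pi.smul_apply, smul_eq_mul]
        exact le_of_eq (by ring))).2 i₁
    simp [ht, (hy i₁).ne'] at this
  refine ⟨c⁻¹ * t, fun i => ?_⟩
  have hc0 : c ≠ 0 := by rintro rfl; simp at hc1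
  have h1 := congrFun hw i
  simp only [Pi.sub_apply, Pi.smul_apply, smul_eq_mul, Pi.zero_apply, sub_eq_zero] at h1
  rw [mul_assoc, ← Complex.ofReal_mul, ← h1, ← hc i, inv_mul_cancel_left₀ hc0]

theorem aeval_mulVec_eigen {A : Matrix (Fin m) (Fin m) ℂ} {h : Fin m → ℂ} {z : ℂ}
    (hh : A *ᵥ h = z • h) (p : ℂ[X]) : aeval A p *ᵥ h = p.eval z • h := by
  induction p using Polynomial.induction_on' with
  | add p q hp hq => rw [map_add, Matrix.add_mulVec, hp, hq, eval_add, add_smul]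
  | monomial n a =>
    rw [aeval_monomial, ← Matrix.mulVec_mulVec, pow_mulVec_eigen hh, Matrix.mulVec_smul,
      Matrix.algebraMap_eq_diagonal, eval_monomial]
    ext i
    simp [Matrix.mulVec_diagonal]
    ring

theorem dotProduct_pos {y z : Fin m → ℝ} [Nonempty (Fin m)] (hy : ∀ i, 0 < y i)
    (hz : ∀ i, 0 < z i) : 0 < y ⬝ᵥ z :=
  Finset.sum_pos (fun i _ => mul_pos (hy i) (hz i)) Finset.univ_nonempty

theorem vecMul_map_eigen {y : Fin m → ℝ} (hy : Bᵀ *ᵥ y = ρ • y) :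
    (fun i => (y i : ℂ)) ᵥ* B.map ((↑) : ℝ → ℂ) = (ρ : ℂ) • fun i => (y i : ℂ) := by
  ext i
  have := congrFun hy i
  rw [Matrix.mulVec_transpose] at this
  rw [← Matrix.mulVec_transpose, ← Matrix.transpose_map, map_ofReal_mulVec, Matrix.mulVec_transpose,
    this]
  simp

theorem mulVec_map_eigen {y : Fin m → ℝ} (hy : B *ᵥ y = ρ • y) :
    B.map ((↑) : ℝ → ℂ) *ᵥ (fun i => (y i : ℂ)) = (ρ : ℂ) • fun i => (y i : ℂ) := by
  ext i
  rw [map_ofReal_mulVec, hy]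
  simp

/-- The spectral radius of a primitive matrix is an algebraically simple eigenvalue. -/
theorem IsSpectralRadius.rootMultiplicity_le_one (h : IsSpectralRadius B ρ) (hB : B.IsPrimitive) :
    (B.map ((↑) : ℝ → ℂ)).charpoly.rootMultiplicity (ρ : ℂ) ≤ 1 := by
  obtain ⟨y, hy, hye⟩ := h.exists_pos_eigen hB
  obtain ⟨l, hl, hle⟩ := h.transpose.exists_pos_eigen (primitive_transpose hB)
  set A := B.map ((↑) : ℝ → ℂ) with hA
  set yc : Fin m → ℂ := fun i => (y i : ℂ) with hyc
  set lc : Fin m → ℂ := fun i => (l i : ℂ) with hlc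
  set N := A.toLin' - (ρ : ℂ) • (1 : Module.End ℂ (Fin m → ℂ)) with hN
  have hNapp : ∀ x, N x = A *ᵥ x - (ρ : ℂ) • x := fun x => by simp [hN]
  have hlN : ∀ x, lc ⬝ᵥ N x = 0 := fun x => by
    rw [hNapp, dotProduct_sub, Matrix.dotProduct_mulVec, vecMul_map_eigen hle, smul_dotProduct,
      dotProduct_smul, sub_self]
  have hker : ∀ x, N x = 0 → ∃ c : ℂ, x = c • yc := fun x hx => by
    rw [hNapp, sub_eq_zero] at hx
    obtain ⟨c, hc⟩ := h.eigen_unique hB hy hye hx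
    exact ⟨c, by ext i; simp [hc, hyc]⟩
  -- If `N x` lies in the kernel it is a multiple of `yc`, but the left Perron vector annihilates
  -- the range of `N` and pairs positively with `yc`. So there are no Jordan chains, and the
  -- generalized eigenspace is at most a line.
  have hstep : ∀ x, N (N x) = 0 → N x = 0 := fun x hx => by
    obtain ⟨c, hc⟩ := hker _ hx
    have h0 := hlN x
    rw [hc, dotProduct_smul, smul_eq_mul, mul_eq_zero] at h0
    rcases h0 with h0 | h0
    · rw [hc, h0, zero_smul]
    · rcases isEmpty_or_nonempty (Fin m) with hm | hm
      · exact Subsingleton.elim _ _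
      · have := dotProduct_pos hl hy
        have e : lc ⬝ᵥ yc = ((l ⬝ᵥ y : ℝ) : ℂ) := by simp [dotProduct, hlc, hyc]
        rw [e, Complex.ofReal_eq_zero] at h0
        exact absurd h0 this.ne'
  have hpow : ∀ (k : ℕ) x, (N ^ k) x = 0 → N x = 0 := by
    intro k
    induction k with
    | zero => intro x hx; simp at hx; simp [hx]
    | succ k ih =>
      intro x hx
      rw [pow_succ, Module.End.mul_apply] at hx
      exact hstep x (ih _ hx)
  have hle : Module.End.maxGenEigenspace A.toLin' (ρ : ℂ) ≤ Submodule.span ℂ {yc} := by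
    intro x hx
    obtain ⟨k, hk⟩ := (Module.End.mem_maxGenEigenspace _ _ _).mp hx
    obtain ⟨c, hc⟩ := hker x (hpow k x hk)
    exact Submodule.mem_span_singleton.mpr ⟨c, hc.symm⟩
  have hfin := (Submodule.finrank_mono hle).trans (finrank_span_le_card ({yc} : Set (Fin m → ℂ)))
  rw [LinearMap.finrank_maxGenEigenspace_eq, Matrix.charpoly_toLin'] at hfin
  simpa using hfin

end Perron

/-- Perron–Frobenius data of a primitive matrix whose eigenvalues are `θ₁, θ₂, …` in the order of
non-increasing modulus: positive right and left eigenvectors, the spectral gap, and the growth of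
the powers on the annihilator of the right eigenvector. -/
theorem exists_perron_data {m : ℕ} {B : Matrix (Fin m) (Fin m) ℝ} (hB : B.IsPrimitive)
    {θ₁ θ₂ : ℂ} {rest : List ℂ}
    (hroots : ((θ₁ :: θ₂ :: rest : List ℂ) : Multiset ℂ) = (B.map ((↑) : ℝ → ℂ)).charpoly.roots)
    (hsort : (θ₁ :: θ₂ :: rest).Pairwise fun z w => ‖w‖ ≤ ‖z‖) (hθ₂ : 1 < ‖θ₂‖) {α : ℕ}
    (hα : (θ₁ :: θ₂ :: rest).countP (fun z => ‖z‖ = ‖θ₂‖) = α + 1) :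
    ‖θ₂‖ < ‖θ₁‖ ∧ ∃ h l : Fin m → ℝ, (∀ i, 0 < h i) ∧ ∑ i, h i = 1 ∧ (∀ i, 0 < l i) ∧
      l ᵥ* B = ‖θ₁‖ • l ∧ ∃ K, ∀ v : Fin m → ℂ, ∑ a, v a * h a = 0 → ∀ M, (∀ a, ‖v a‖ ≤ M) →
        ∀ (n : ℕ) b, ‖(v ᵥ* (B.map ((↑) : ℝ → ℂ)) ^ n) b‖ ≤ K * M * (n + 1) ^ α * ‖θ₂‖ ^ n := by
  set A := B.map ((↑) : ℝ → ℂ) with hA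
  rw [List.pairwise_cons, List.pairwise_cons] at hsort
  obtain ⟨hs1, hs2, -⟩ := hsort
  have h21 : ‖θ₂‖ ≤ ‖θ₁‖ := hs1 _ (by simp)
  have hρ : IsSpectralRadius B ‖θ₁‖ := by
    refine ⟨by linarith, fun z hz => ?_, θ₁, ?_, rfl⟩
    · rw [← hA, ← hroots] at hz
      rcases List.mem_cons.mp (Multiset.mem_coe.mp hz) with rfl | hz
      · exact le_rfl
      · exact hs1 z hz
    · rw [← hA, ← hroots]; simp
  have hθ₁ : θ₁ = (‖θ₁‖ : ℂ) := hρ.eq_of_norm_eq hB (by rw [← hA, ← hroots]; simp) rfl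
  have hlt : ‖θ₂‖ < ‖θ₁‖ := by
    refine lt_of_le_of_ne h21 fun heq => ?_
    -- With equal moduli both `θ₁` and `θ₂` would be the Perron root, which would then have
    -- multiplicity at least two.
    have e2 := hρ.eq_of_norm_eq hB (z := θ₂) (by rw [← hA, ← hroots]; simp) heq
    have := hρ.rootMultiplicity_le_one hB
    rw [← hA, ← Polynomial.count_roots, ← hroots, ← hθ₁, Multiset.coe_count, e2, ← hθ₁] at this
    simp at this
  refine ⟨hlt, ?_⟩
  obtain ⟨l, hl, hle⟩ := hρ.transpose.exists_pos_eigen (primitive_transpose hB)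
  obtain ⟨y, hy, hye⟩ := hρ.exists_pos_eigen hB
  have hm : Nonempty (Fin m) := by
    by_contra hempty
    rw [not_nonempty_iff] at hempty
    have hdeg := Polynomial.card_roots' A.charpoly
    rw [← hroots, Matrix.charpoly_natDegree_eq_dim] at hdeg
    simp at hdeg
  have hsum : 0 < ∑ i, y i := Finset.sum_pos (fun i _ => hy i) Finset.univ_nonempty
  set h : Fin m → ℝ := (∑ i, y i)⁻¹ • y with hh
  have hpos : ∀ i, 0 < h i := fun i => mul_pos (inv_pos.mpr hsum) (hy i)
  have hhe : B *ᵥ h = ‖θ₁‖ • h := by rw [hh, Matrix.mulVec_smul, hye, smul_comm]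
  have hh1 : ∑ i, h i = 1 := by
    simp only [hh, Pi.smul_apply, smul_eq_mul, ← Finset.mul_sum]
    exact inv_mul_cancel₀ hsum.ne'
  refine ⟨h, l, hpos, hh1, hl, by rw [← Matrix.mulVec_transpose, hle], ?_⟩
  set q : ℂ[X] := (((θ₂ :: rest : List ℂ) : Multiset ℂ).map fun z => X - C z).prod with hq
  have hchar : A.charpoly = (X - C θ₁) * q := by
    rw [Polynomial.Splits.eq_prod_roots_of_monic (IsAlgClosed.splits _) A.charpoly_monic, ← hroots,
      ← Multiset.cons_coe, Multiset.map_cons, Multiset.prod_cons]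
  set hc : Fin m → ℂ := fun i => (h i : ℂ) with hhc
  -- the left action of `q` kills the annihilator of `h`
  have hkill : ∀ g : Fin m → ℂ, g ⬝ᵥ hc = 0 → g ᵥ* aeval A q = 0 := by
    intro g hg
    -- By Cayley–Hamilton `w` satisfies the left eigenvector equation for `θ₁`, hence is a multiple
    -- of `l`. Its pairing with `h` is `q(θ₁)` times that of `g`, so zero, whereas `l` pairs
    -- positively with `h`.
    set w := g ᵥ* aeval A q with hw
    have h1 : Aᵀ *ᵥ w = ((‖θ₁‖ : ℝ) : ℂ) • w := by
      have := Matrix.aeval_self_charpoly A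
      rw [hchar, mul_comm, map_mul, map_sub, aeval_X, aeval_C, mul_sub, sub_eq_zero] at this
      rw [Matrix.mulVec_transpose, hw, Matrix.vecMul_vecMul, this, ← hθ₁, ← Algebra.commutes,
        ← Algebra.smul_def, Matrix.vecMul_smul]
    obtain ⟨c, hc'⟩ := hρ.transpose.eigen_unique (primitive_transpose hB) hl hle
      (by rw [Matrix.transpose_map]; exact h1)
    have h2 : w ⬝ᵥ hc = 0 := by
      rw [hw, ← Matrix.dotProduct_mulVec, aeval_mulVec_eigen (mulVec_map_eigen hhe),
        dotProduct_smul, hg, smul_zero]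
    have h3 : w ⬝ᵥ hc = c * ((l ⬝ᵥ h : ℝ) : ℂ) := by
      simp [dotProduct, hc', hhc, Finset.mul_sum, mul_assoc]
    rw [h3, mul_eq_zero, Complex.ofReal_eq_zero] at h2
    have hc0 : c = 0 := h2.resolve_right (dotProduct_pos hl hpos).ne'
    ext i
    simp [hc', hc0]
  have hcount : ((θ₂ :: rest : List ℂ) : Multiset ℂ).countP (fun z => ‖z‖ = ‖θ₂‖) = α + 1 := by
    rw [List.countP_cons_of_neg (by simpa using hlt.ne')] at hα
    rw [Multiset.coe_countP]
    exact hα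
  -- The vectors `e_a - h_a (1,…,1)` lie in the annihilator of `h`, and every `v` there is their
  -- combination with coefficients `v a`. Finitely many recurrences therefore give a constant
  -- uniform in `v`.
  have key : ∀ a b : Fin m, ∃ K, ∀ n : ℕ,
      ‖((Pi.single a 1 - (fun _ => hc a) : Fin m → ℂ) ᵥ* A ^ n) b‖
        ≤ K * (n + 1) ^ α * ‖θ₂‖ ^ n := by
    intro a b
    set g : Fin m → ℂ := Pi.single a 1 - (fun _ => hc a) with hg
    have hg0 : g ⬝ᵥ hc = 0 := by
      have : ∑ i, hc i = 1 := by rw [hhc, ← Complex.ofReal_sum, hh1, Complex.ofReal_one]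
      rw [hg, sub_dotProduct, single_dotProduct, one_mul]
      simp only [dotProduct, ← Finset.mul_sum, this, mul_one, sub_self]
    let Φ : ℂ[X] →ₗ[ℂ] ℂ :=
      { toFun := fun p => (g ᵥ* aeval A p) b
        map_add' := fun p p' => by simp [Matrix.vecMul_add]
        map_smul' := fun c p => by simp [Matrix.vecMul_smul] }
    have := exists_bound_of_recurrence Φ (by linarith : 0 < ‖θ₂‖) _ (fun z hz => by
      rcases List.mem_cons.mp (Multiset.mem_coe.mp hz) with rfl | hz
      · exact le_rfl
      · exact hs2 z hz) hcount fun n => by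
        change (g ᵥ* aeval A (X ^ n * q)) b = 0
        rw [mul_comm, map_mul, ← Matrix.vecMul_vecMul, hkill g hg0]
        simp
    simpa [Φ] using this
  choose K hK using key
  refine ⟨∑ a, ∑ b, |K a b|, fun v hv M hM n b => ?_⟩
  have hdecomp : v = ∑ a, v a • (Pi.single a 1 - (fun _ => hc a) : Fin m → ℂ) := by
    ext i
    simp only [Finset.sum_apply, Pi.smul_apply, Pi.sub_apply, smul_eq_mul, mul_sub,
      Finset.sum_sub_distrib, hhc, hv, sub_zero]
    simp [Pi.single_apply]
  have hM0 : 0 ≤ M := (norm_nonneg _).trans (hM b)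
  calc ‖(v ᵥ* A ^ n) b‖
      = ‖∑ a, v a * ((Pi.single a 1 - (fun _ => hc a) : Fin m → ℂ) ᵥ* A ^ n) b‖ := by
        conv_lhs => rw [hdecomp, Matrix.sum_vecMul]
        simp [Finset.sum_apply, Matrix.smul_vecMul]
    _ ≤ ∑ a, M * ((∑ b, |K a b|) * (n + 1) ^ α * ‖θ₂‖ ^ n) := by
        refine (norm_sum_le _ _).trans (Finset.sum_le_sum fun a _ => ?_)
        rw [norm_mul]
        refine mul_le_mul (hM a) ((hK a b n).trans ?_) (norm_nonneg _) hM0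
        gcongr
        exact (le_abs_self _).trans (Finset.single_le_sum (f := fun b => |K a b|)
          (fun _ _ => abs_nonneg _) (Finset.mem_univ b))
    _ = _ := by simp only [← Finset.mul_sum, ← Finset.sum_mul]; ring

/-! ### Sums over words -/

/-- The sum of the values of `v` along the word `w`. -/
def wordSum {ι R : Type*} [AddMonoid R] (v : ι → R) (w : List ι) : R := (w.map v).sum

section Words

variable {ι R : Type*}

@[simp] theorem wordSum_nil [AddMonoid R] (v : ι → R) : wordSum v [] = 0 := rfl

@[simp] theorem wordSum_cons [AddMonoid R] (v : ι → R) (a : ι) (w : List ι) :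
    wordSum v (a :: w) = v a + wordSum v w := by simp [wordSum]

@[simp] theorem wordSum_append [AddMonoid R] (v : ι → R) (w w' : List ι) :
    wordSum v (w ++ w') = wordSum v w + wordSum v w' := by simp [wordSum]

theorem norm_wordSum_le {v : ι → ℂ} {M : ℝ} (h : ∀ a, ‖v a‖ ≤ M) (w : List ι) :
    ‖wordSum v w‖ ≤ M * w.length := by
  induction w with
  | nil => simp
  | cons a w ih =>
    rw [wordSum_cons, List.length_cons]
    push_cast
    linarith [norm_add_le (v a) (wordSum v w), h a]

theorem wordSum_le {v : ι → ℝ} {M : ℝ} (h : ∀ a, v a ≤ M) (w : List ι) :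
    wordSum v w ≤ M * w.length := by
  induction w with
  | nil => simp
  | cons a w ih =>
    rw [wordSum_cons, List.length_cons]
    push_cast
    linarith [h a]

theorem le_wordSum {v : ι → ℝ} {c : ℝ} (h : ∀ a, c ≤ v a) (w : List ι) :
    c * w.length ≤ wordSum v w := by
  induction w with
  | nil => simp
  | cons a w ih =>
    rw [wordSum_cons, List.length_cons]
    push_cast
    linarith [h a]

theorem exists_of_prefix_flatMap {κ : Type*} {f : ι → List κ} {L : ℕ} (hL : ∀ a, (f a).length ≤ L)
    (u : List ι) : ∀ w, w <+: u.flatMap f →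
      ∃ u' q, u' <+: u ∧ q.length ≤ L ∧ w = u'.flatMap f ++ q := by
  induction u with
  | nil => intro w hw; exact ⟨[], [], by simp, by simp, by simpa using hw⟩
  | cons c u ih =>
    intro w hw
    rw [List.flatMap_cons] at hw
    rcases List.prefix_or_prefix_of_prefix hw (List.prefix_append (f c) (u.flatMap f)) with h | h
    · exact ⟨[], w, by simp, h.length_le.trans (hL c), by simp⟩
    · obtain ⟨t, rfl⟩ := h
      obtain ⟨u', q, hu', hq, rfl⟩ := ih t ((List.prefix_append_right_inj _).mp hw)
      exact ⟨c :: u', q, by simpa using hu', hq, by simp⟩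

/-- A subword of a concatenation covers whole blocks except for partial ones at its two ends; a
subword of a single block is taken entirely as `p`. -/
theorem exists_of_infix_flatMap {κ : Type*} {f : ι → List κ} {L : ℕ} (hL : ∀ a, (f a).length ≤ L)
    (u : List ι) : ∀ w, w <:+: u.flatMap f →
      ∃ p u' q, u' <:+: u ∧ p.length ≤ L ∧ q.length ≤ L ∧ w = p ++ u'.flatMap f ++ q := by
  induction u with
  | nil => intro w hw; exact ⟨[], [], [], by simp, by simp, by simp, by simpa using hw⟩
  | cons c u ih =>
    intro w hw
    rw [List.flatMap_cons, List.infix_append_iff] at hw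
    rcases hw with h | h | ⟨t₁, t₂, rfl, h₁, h₂⟩
    · exact ⟨w, [], [], by simp, h.length_le.trans (hL c), by simp, by simp⟩
    · obtain ⟨p, u', q, hu', hp, hq, rfl⟩ := ih w h
      exact ⟨p, u', q, List.infix_cons hu', hp, hq, rfl⟩
    · obtain ⟨u', q, hu', hq, rfl⟩ := exists_of_prefix_flatMap hL u t₂ h₂
      exact ⟨t₁, u', q, List.infix_cons hu'.isInfix, h₁.length_le.trans (hL c), hq, by simp⟩

end Words

/-! ### Desubstitution and the growth of sums over words of the language -/

section Language

variable {m : ℕ} (ζ : Substitution m)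

/-- The language of a substitution: all subwords of the words `ζ^k(a)`. -/
def language : Set (List (Fin m)) := {w | ∃ (k : ℕ) (a : Fin m), w <:+: ζ.iter k a}

theorem wordSum_word {R : Type*} [CommSemiring R] (v : Fin m → R) (b : Fin m) :
    wordSum v (ζ.word b) = (v ᵥ* ζ.matrix.map (Nat.cast : ℕ → R)) b := by
  rw [wordSum, Finset.sum_list_map_count,
    Finset.sum_subset (Finset.subset_univ _) fun a _ ha => by
      rw [List.count_eq_zero.mpr (by simpa using ha), zero_smul]]
  simp [Matrix.vecMul, dotProduct, Substitution.matrix, mul_comm]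

theorem wordSum_apply {R : Type*} [CommSemiring R] (v : Fin m → R) (u : List (Fin m)) :
    wordSum v (ζ.apply u) = wordSum (v ᵥ* ζ.matrix.map (Nat.cast : ℕ → R)) u := by
  induction u with
  | nil => rfl
  | cons a u ih =>
    rw [Substitution.apply, List.flatMap_cons, wordSum_append, wordSum_word, wordSum_cons, ← ih]
    rfl

theorem exists_word_length_le : ∃ L : ℕ, 1 ≤ L ∧ ∀ a, (ζ.word a).length ≤ L :=
  ⟨∑ a, (ζ.word a).length + 1, by omega, fun a =>
    (Finset.single_le_sum (f := fun a => (ζ.word a).length) (fun _ _ => Nat.zero_le _)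
      (Finset.mem_univ a)).trans (Nat.le_succ _)⟩

variable {ζ}

theorem exists_desubstitution {L : ℕ} (hL1 : 1 ≤ L) (hL : ∀ a, (ζ.word a).length ≤ L)
    {w : List (Fin m)} (hw : w ∈ language ζ) :
    ∃ p u q, u ∈ language ζ ∧ p.length ≤ L ∧ q.length ≤ L ∧ w = p ++ ζ.apply u ++ q := by
  obtain ⟨k, a, hw⟩ := hw
  cases k with
  | zero =>
    -- A subword of a single letter has length at most one, so it counts as an end word with empty
    -- core; this is where `1 ≤ L` enters.
    refine ⟨w, [], [], ⟨0, a, by simp⟩, hw.length_le.trans ?_, by simp, by simp [Substitution.apply]⟩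
    simpa [Substitution.iter] using hL1
  | succ k =>
    rw [Substitution.iter, Function.iterate_succ_apply'] at hw
    obtain ⟨p, u, q, hu, hp, hq, rfl⟩ := exists_of_infix_flatMap hL _ _ hw
    exact ⟨p, u, q, ⟨k, a, hu⟩, hp, hq, rfl⟩

/-- Each level trades `v` for `v S` and discards two end words of length at most `L`. Since `l` is a
left eigenvector, its sum over the word shrinks at least by the factor `ρ` per level, which controls
the length of the final core. -/
theorem exists_iterated_desubstitution {L : ℕ} (hL1 : 1 ≤ L) (hL : ∀ a, (ζ.word a).length ≤ L)
    {l : Fin m → ℝ} {ρ : ℝ} (hρ : 0 < ρ) (hl : ∀ a, 0 < l a)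
    (hle : l ᵥ* ζ.matrix.map (Nat.cast : ℕ → ℝ) = ρ • l)
    {v : Fin m → ℂ} {D : ℕ → ℝ}
    (hD : ∀ n b, ‖(v ᵥ* ζ.matrix.map (Nat.cast : ℕ → ℂ) ^ n) b‖ ≤ D n)
    {w : List (Fin m)} (hw : w ∈ language ζ) (j : ℕ) :
    ∃ u ∈ language ζ, ρ ^ j * wordSum l u ≤ wordSum l w ∧
      ‖wordSum v w‖ ≤ 2 * L * ∑ i ∈ Finset.range j, D i +
        ‖wordSum (v ᵥ* ζ.matrix.map (Nat.cast : ℕ → ℂ) ^ j) u‖ := by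
  induction j with
  | zero => exact ⟨w, hw, by simp, by simp⟩
  | succ j ih =>
    obtain ⟨u, hu, hlu, hvu⟩ := ih
    obtain ⟨p, u', q, hu', hp, hq, rfl⟩ := exists_desubstitution hL1 hL hu
    refine ⟨u', hu', le_trans ?_ hlu, hvu.trans ?_⟩
    · have h0 : ∀ w', 0 ≤ wordSum l w' := fun w' => by
        simpa using le_wordSum (fun a => (hl a).le) w'
      have h1 : wordSum l (ζ.apply u') = ρ * wordSum l u' := by
        rw [wordSum_apply, hle, wordSum, wordSum, ← List.sum_map_mul_left]; rfl
      rw [wordSum_append, wordSum_append, h1, pow_succ, mul_assoc]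
      gcongr
      linarith [h0 p, h0 q]
    · have hb : ∀ w' : List (Fin m), w'.length ≤ L →
          ‖wordSum (v ᵥ* ζ.matrix.map (Nat.cast : ℕ → ℂ) ^ j) w'‖ ≤ L * D j := by
        intro w' hw'
        rcases w' with _ | ⟨a, w'⟩
        · obtain ⟨k, a, -⟩ := hw
          simpa using mul_nonneg (Nat.cast_nonneg L) ((norm_nonneg _).trans (hD j a))
        · refine (norm_wordSum_le (hD j) _).trans ?_
          rw [mul_comm]
          have := (norm_nonneg _).trans (hD j a)
          gcongr
      rw [wordSum_append, wordSum_append, wordSum_apply, Matrix.vecMul_vecMul, ← pow_succ,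
        Finset.sum_range_succ, mul_add]
      have := norm_add₃_le (a := wordSum (v ᵥ* ζ.matrix.map (Nat.cast : ℕ → ℂ) ^ j) p)
        (b := wordSum (v ᵥ* ζ.matrix.map (Nat.cast : ℕ → ℂ) ^ (j + 1)) u')
        (c := wordSum (v ᵥ* ζ.matrix.map (Nat.cast : ℕ → ℂ) ^ j) q)
      linarith [hb p hp, hb q hq]

theorem sum_range_pow_mul_le {R : ℝ} (hR : 1 < R) (α j : ℕ) :
    ∑ i ∈ Finset.range j, ((i : ℝ) + 1) ^ α * R ^ i ≤ (j + 1) ^ α * R ^ j / (R - 1) := by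
  have h1 : 0 < R - 1 := by linarith
  calc ∑ i ∈ Finset.range j, ((i : ℝ) + 1) ^ α * R ^ i
      ≤ ∑ i ∈ Finset.range j, ((j : ℝ) + 1) ^ α * R ^ i := by
        refine Finset.sum_le_sum fun i hi => ?_
        have : (i : ℝ) ≤ j := by exact_mod_cast (Finset.mem_range.mp hi).le
        gcongr
    _ = (j + 1) ^ α * ((R ^ j - 1) / (R - 1)) := by rw [← Finset.mul_sum, geom_sum_eq hR.ne']
    _ ≤ (j + 1) ^ α * (R ^ j / (R - 1)) := by gcongr; linarith
    _ = _ := by ring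

/-- Words of the language have small sums of a vector on which the powers of the substitution
matrix grow slowly. -/
theorem exists_wordSum_pow_bound {l : Fin m → ℝ} {ρ R K : ℝ} {α : ℕ} (hρ : 0 < ρ) (hR : 1 < R)
    (hl : ∀ a, 0 < l a) (hle : l ᵥ* ζ.matrix.map (Nat.cast : ℕ → ℝ) = ρ • l) :
    ∃ K', ∀ (v : Fin m → ℂ) (M : ℝ),
      (∀ (n : ℕ) b, ‖(v ᵥ* ζ.matrix.map (Nat.cast : ℕ → ℂ) ^ n) b‖
        ≤ K * M * (n + 1) ^ α * R ^ n) →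
      ∀ w ∈ language ζ, ∀ j : ℕ, (w.length : ℝ) ≤ ρ ^ j →
        ‖wordSum v w‖ ≤ K' * (K * M) * (j + 1) ^ α * R ^ j := by
  obtain ⟨L, hL1, hL⟩ := exists_word_length_le ζ
  rcases isEmpty_or_nonempty (Fin m) with hm | hm
  · exact ⟨0, fun _ _ _ w ⟨_, a, _⟩ => isEmptyElim a⟩
  obtain ⟨a₀, ha₀⟩ := Finite.exists_min l
  obtain ⟨a₁, ha₁⟩ := Finite.exists_max l
  have hl0 := hl a₀
  -- The first term is the geometric sum over the discarded end words; the second bounds the length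
  -- of the core left after `j` levels.
  refine ⟨2 * L / (R - 1) + l a₁ / l a₀, fun v M hD w hw j hj => ?_⟩
  have hKM : 0 ≤ K * M := by simpa using (norm_nonneg _).trans (hD 0 a₀)
  obtain ⟨u, hu, hlu, hvu⟩ := exists_iterated_desubstitution hL1 hL hρ hl hle hD hw j
  have hlen : (u.length : ℝ) ≤ l a₁ / l a₀ := by
    rw [le_div_iff₀ hl0]
    have h1 := le_wordSum ha₀ u
    have h2 := wordSum_le ha₁ w
    have h3 : l a₁ * w.length ≤ l a₁ * ρ ^ j := by have := (hl a₁).le; gcongr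
    have h4 : ρ ^ j * wordSum l u ≤ ρ ^ j * l a₁ := by linarith
    have h5 := le_of_mul_le_mul_left h4 (by positivity)
    linarith
  have h1 := norm_wordSum_le (hD j) u
  have h2 : ∑ i ∈ Finset.range j, K * M * ((i : ℝ) + 1) ^ α * R ^ i
      ≤ K * M * ((j + 1) ^ α * R ^ j / (R - 1)) := by
    simp only [mul_assoc (K * M), ← Finset.mul_sum]
    gcongr
    exact sum_range_pow_mul_le hR α j
  have hR1 : 0 < R - 1 := by linarith
  calc ‖wordSum v w‖ ≤ 2 * L * (K * M * ((j + 1) ^ α * R ^ j / (R - 1)))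
        + K * M * (j + 1) ^ α * R ^ j * (l a₁ / l a₀) := by
        refine hvu.trans (add_le_add ?_ (h1.trans ?_)) <;> gcongr
    _ = _ := by ring

/-- Rounding the number of levels up costs at most one factor `R`, because `N ^ logb ρ R = R ^ logb
ρ N`. -/
theorem pow_ceil_logb_le {ρ R N : ℝ} (hρ : 1 < ρ) (hR : 1 < R) (hN : 1 ≤ N) :
    R ^ ⌈Real.logb ρ N⌉₊ ≤ R * N ^ Real.logb ρ R := by
  have h0 : 0 ≤ Real.logb ρ N := Real.logb_nonneg hρ hN
  have hN0 : 0 < N := by linarith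
  have e : N ^ Real.logb ρ R = R ^ Real.logb ρ N := by
    rw [Real.rpow_def_of_pos hN0, Real.rpow_def_of_pos (by linarith), Real.logb, Real.logb]
    congr 1; ring
  rw [e, ← Real.rpow_natCast, mul_comm, ← Real.rpow_add_one (by linarith)]
  exact Real.rpow_le_rpow_of_exponent_le hR.le (Nat.ceil_lt_add_one h0).le

theorem exists_wordSum_bound {l : Fin m → ℝ} {ρ R K : ℝ} {α : ℕ} (hR : 1 < R) (hρ : 1 < ρ)
    (hl : ∀ a, 0 < l a) (hle : l ᵥ* ζ.matrix.map (Nat.cast : ℕ → ℝ) = ρ • l) :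
    ∃ K', 0 ≤ K' ∧ ∀ (v : Fin m → ℂ) (M : ℝ), 0 ≤ M →
      (∀ (n : ℕ) b, ‖(v ᵥ* ζ.matrix.map (Nat.cast : ℕ → ℂ) ^ n) b‖
        ≤ K * M * (n + 1) ^ α * R ^ n) →
      ∀ w ∈ language ζ, ∀ N : ℝ, 1 ≤ N → (w.length : ℝ) ≤ N →
        ‖wordSum v w‖ ≤ K' * M * (1 + Real.log N) ^ α * N ^ Real.logb ρ R := by
  obtain ⟨K₁, hK₁⟩ := exists_wordSum_pow_bound (α := α) (K := K) (by linarith : 0 < ρ) hR hl hle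
  have hlρ : 0 < Real.log ρ := Real.log_pos hρ
  -- Chosen so that `j + 1 ≤ logb ρ N + 2 ≤ c * (1 + log N)`.
  set c := 2 + (Real.log ρ)⁻¹ with hc
  have hc0 : 0 < c := by positivity
  refine ⟨|K₁ * K| * c ^ α * R, by positivity, fun v M hM hD w hw N hN hwN => ?_⟩
  set j := ⌈Real.logb ρ N⌉₊
  have hN0 : 0 < N := by linarith
  have hlog : 0 ≤ Real.log N := Real.log_nonneg hN
  have hj : (w.length : ℝ) ≤ ρ ^ j := by
    refine hwN.trans ?_
    rw [← Real.rpow_natCast, ← Real.logb_le_iff_le_rpow hρ hN0]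
    exact Nat.le_ceil _
  have hj1 : (j : ℝ) + 1 ≤ c * (1 + Real.log N) := by
    have : (j : ℝ) ≤ Real.logb ρ N + 1 := (Nat.ceil_lt_add_one (Real.logb_nonneg hρ hN)).le
    have h1 : Real.logb ρ N = (Real.log ρ)⁻¹ * Real.log N := by rw [Real.logb]; ring
    rw [h1] at this
    have h2 : 0 < (Real.log ρ)⁻¹ := by positivity
    rw [hc]
    nlinarith
  have hpow := pow_ceil_logb_le hρ hR hN
  calc ‖wordSum v w‖ ≤ K₁ * (K * M) * (j + 1) ^ α * R ^ j := hK₁ v M hD w hw j hj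
    _ = (K₁ * K) * M * (j + 1) ^ α * R ^ j := by ring
    _ ≤ |K₁ * K| * M * (c * (1 + Real.log N)) ^ α * (R * N ^ Real.logb ρ R) := by
        gcongr
        exact le_abs_self _
    _ = _ := by rw [mul_pow]; ring

end Language

/-! ### The suspension flow along a fibre -/

section Fibre

variable {m : ℕ} {s : Fin m → ℝ}

theorem roofSum_zero (s : Fin m → ℝ) (x : ℤ → Fin m) : roofSum s x 0 = 0 := by simp [roofSum]

theorem roofSum_strictMono (hs : ∀ a, 0 < s a) (x : ℤ → Fin m) : StrictMono (roofSum s x) :=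
  strictMono_int_of_lt_succ fun n => by rw [roofSum_succ]; linarith [hs (x n)]

theorem roofIndex_eq (hs : ∀ a, 0 < s a) {x : ℤ → Fin m} {u : ℝ} {n : ℤ}
    (h₁ : roofSum s x n ≤ u) (h₂ : u < roofSum s x (n + 1)) : roofIndex hs x u = n := by
  obtain ⟨h₃, h₄⟩ := roofIndex_spec hs x u
  have hm := roofSum_strictMono hs x
  have h5 := hm.lt_iff_lt.mp (h₁.trans_lt h₄)
  have h6 := hm.lt_iff_lt.mp (h₃.trans_lt h₂)
  omega

theorem roofSum_shift (s : Fin m → ℝ) (x : ℤ → Fin m) (n : ℤ) :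
    roofSum s (fun j => x (j + 1)) n = roofSum s x (n + 1) - s (x 0) := by
  have hstep : ∀ k : ℤ, roofSum s (fun j => x (j + 1)) (k + 1) - roofSum s x (k + 1 + 1)
      = roofSum s (fun j => x (j + 1)) k - roofSum s x (k + 1) := fun k => by
    rw [roofSum_succ, roofSum_succ s x (k + 1)]; ring
  have key : roofSum s (fun j => x (j + 1)) n - roofSum s x (n + 1) = - s (x 0) := by
    induction n using Int.induction_on with
    | zero => rw [roofSum_succ, roofSum_zero, roofSum_zero]; ring
    | succ i ih => rw [hstep, ih]
    | pred i ih =>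
      rw [← ih]
      have := hstep (-(i : ℤ) - 1)
      rw [sub_add_cancel] at this
      rw [sub_add_cancel]
      exact this.symm
  linarith

/-- The cylindrical function given by `ψ` read along the fibre of `x`. -/
noncomputable def fibre (hs : ∀ a, 0 < s a) (ψ : Fin m → ℝ → ℂ) (x : ℤ → Fin m) (u : ℝ) : ℂ :=
  ψ (x (roofIndex hs x u)) (u - roofSum s x (roofIndex hs x u))

theorem fibre_eq (hs : ∀ a, 0 < s a) (ψ : Fin m → ℝ → ℂ) {x : ℤ → Fin m} {u : ℝ} {n : ℤ}
    (h₁ : roofSum s x n ≤ u) (h₂ : u < roofSum s x (n + 1)) :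
    fibre hs ψ x u = ψ (x n) (u - roofSum s x n) := by
  rw [fibre, roofIndex_eq hs h₁ h₂]

/-- Shifting `x` moves the origin of the fibre to the top of its first letter. This is the
equivariance behind the invariance of correlations. -/
theorem fibre_shift (hs : ∀ a, 0 < s a) (ψ : Fin m → ℝ → ℂ) (x : ℤ → Fin m) (u : ℝ) :
    fibre hs ψ (fun j => x (j + 1)) u = fibre hs ψ x (u + s (x 0)) := by
  obtain ⟨h₁, h₂⟩ := roofIndex_spec hs (fun j => x (j + 1)) u
  rw [roofSum_shift] at h₁ h₂
  rw [fibre, fibre_eq hs ψ (n := roofIndex hs (fun j => x (j + 1)) u + 1) (by linarith)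
    (by linarith), roofSum_shift]
  congr 1
  ring

theorem norm_fibre_le (hs : ∀ a, 0 < s a) {ψ : Fin m → ℝ → ℂ} {M : ℝ} (hM : ∀ a t, ‖ψ a t‖ ≤ M)
    (x : ℤ → Fin m) (u : ℝ) : ‖fibre hs ψ x u‖ ≤ M := hM _ _

theorem cylindrical_flow (ζ : Substitution m) (hs : ∀ a, 0 < s a) (ψ : Fin m → ℝ → ℂ) (τ : ℝ)
    (y : suspension ζ s) :
    cylindrical ζ s ψ (flow ζ hs τ y) = fibre hs ψ y.1.1.1 (y.1.2 + τ) := by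
  simp [cylindrical, flow, shift, fibre]

theorem cylindrical_eq_fibre (ζ : Substitution m) (hs : ∀ a, 0 < s a) (ψ : Fin m → ℝ → ℂ)
    (y : suspension ζ s) : cylindrical ζ s ψ y = fibre hs ψ y.1.1.1 y.1.2 := by
  obtain ⟨h₁, h₂⟩ := y.2
  rw [fibre_eq hs ψ (n := 0) (by rwa [roofSum_zero]) (by rwa [roofSum_succ, roofSum_zero, zero_add]),
    roofSum_zero, sub_zero]
  rfl

variable {ζ : Substitution m}

theorem measurable_coord (n : ℤ) : Measurable fun x : Space ζ => x.1 n :=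
  (measurable_pi_apply n).comp measurable_subtype_coe

theorem measurable_roofSum (s : Fin m → ℝ) (n : ℤ) :
    Measurable fun x : Space ζ => roofSum s x.1 n := by
  have h : ∀ j : ℤ, Measurable fun x : Space ζ => s (x.1 j) := fun j =>
    (Measurable.of_discrete (f := s)).comp (measurable_coord j)
  exact (Finset.measurable_sum _ fun j _ => h j).sub (Finset.measurable_sum _ fun j _ => h j)

theorem measurable_roofIndex (hs : ∀ a, 0 < s a) :
    Measurable fun p : Space ζ × ℝ => roofIndex hs p.1.1 p.2 := by
  refine measurable_to_countable' fun n => ?_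
  have : (fun p : Space ζ × ℝ => roofIndex hs p.1.1 p.2) ⁻¹' {n}
      = {p | roofSum s p.1.1 n ≤ p.2} ∩ {p | p.2 < roofSum s p.1.1 (n + 1)} := by
    ext p
    constructor
    · rintro rfl; exact roofIndex_spec hs p.1.1 p.2
    · rintro ⟨h₁, h₂⟩; exact roofIndex_eq hs h₁ h₂
  rw [this]
  exact (measurableSet_le ((measurable_roofSum s n).comp measurable_fst) measurable_snd).inter
    (measurableSet_lt measurable_snd ((measurable_roofSum s (n + 1)).comp measurable_fst))

theorem measurable_fibre (hs : ∀ a, 0 < s a) {ψ : Fin m → ℝ → ℂ} (hψ : ∀ a, Measurable (ψ a)) :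
    Measurable fun p : Space ζ × ℝ => fibre hs ψ p.1.1 p.2 := by
  have h1 : Measurable fun q : Fin m × ℝ => ψ q.1 q.2 :=
    measurable_from_prod_countable_right fun a => hψ a
  have h2 : Measurable fun q : ℤ × (Space ζ × ℝ) =>
      ψ (q.2.1.1 q.1) (q.2.2 - roofSum s q.2.1.1 q.1) :=
    measurable_from_prod_countable_right fun n =>
      h1.comp (((measurable_coord n).comp measurable_fst).prodMk
        (measurable_snd.sub ((measurable_roofSum s n).comp measurable_fst)))
  exact h2.comp ((measurable_roofIndex hs).prodMk measurable_id)

theorem measurable_fibre_right (hs : ∀ a, 0 < s a) {ψ : Fin m → ℝ → ℂ}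
    (hψ : ∀ a, Measurable (ψ a)) (x : Space ζ) : Measurable (fibre hs ψ x.1) :=
  (measurable_fibre hs hψ).comp measurable_prodMk_left

theorem intervalIntegrable_of_bounded {f : ℝ → ℂ} {M : ℝ} (hf : Measurable f)
    (hM : ∀ u, ‖f u‖ ≤ M) (a b : ℝ) : IntervalIntegrable f volume a b := by
  rw [intervalIntegrable_iff]
  exact Measure.integrableOn_of_bounded (M := M) (by simp) hf.aestronglyMeasurable
    (Filter.Eventually.of_forall hM)

/-- The integrals of a cylindrical function over the letters. -/
noncomputable def letterIntegral (s : Fin m → ℝ) (ψ : Fin m → ℝ → ℂ) (a : Fin m) : ℂ := ∫ t in 0..s a, ψ a t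

theorem block_succ (x : ℤ → Fin m) (p : ℤ) (k : ℕ) : block x p (k + 1) = block x p k ++ [x (p + k)] := by
  simp [block, List.range_succ]

theorem integral_fibre_letter (hs : ∀ a, 0 < s a) (ψ : Fin m → ℝ → ℂ) (x : ℤ → Fin m) (n : ℤ) :
    ∫ u in roofSum s x n..roofSum s x (n + 1), fibre hs ψ x u = letterIntegral s ψ (x n) := by
  have hle : roofSum s x n ≤ roofSum s x (n + 1) := (roofSum_strictMono hs x (by omega)).le
  have : ∫ u in roofSum s x n..roofSum s x (n + 1), fibre hs ψ x u
      = ∫ u in roofSum s x n..roofSum s x (n + 1), ψ (x n) (u - roofSum s x n) := by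
    -- The fibre formula is valid on the half-open interval closed at the bottom; the endpoint is
    -- null.
    rw [intervalIntegral.integral_of_le hle, intervalIntegral.integral_of_le hle,
      ← integral_Ico_eq_integral_Ioc, ← integral_Ico_eq_integral_Ioc]
    exact setIntegral_congr_fun measurableSet_Ico fun u hu => fibre_eq hs ψ hu.1 hu.2
  rw [this, intervalIntegral.integral_comp_sub_right (fun t => ψ (x n) t), sub_self, roofSum_succ,
    add_sub_cancel_left]
  rfl

theorem integral_fibre_block (hs : ∀ a, 0 < s a) {ψ : Fin m → ℝ → ℂ} {M : ℝ}
    (hψ : ∀ a, Measurable (ψ a)) (hM : ∀ a t, ‖ψ a t‖ ≤ M) (x : Space ζ) (p : ℤ) (k : ℕ) :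
    ∫ u in roofSum s x.1 p..roofSum s x.1 (p + k), fibre hs ψ x.1 u
      = wordSum (letterIntegral s ψ) (block x.1 p k) := by
  have hint := intervalIntegrable_of_bounded (measurable_fibre_right hs hψ x)
    (norm_fibre_le hs hM x.1)
  induction k with
  | zero => simp [block]
  | succ k ih =>
    rw [block_succ, wordSum_append, ← ih, wordSum_cons, wordSum_nil, add_zero,
      ← integral_fibre_letter hs ψ x.1 (p + k),
      intervalIntegral.integral_add_adjacent_intervals (hint _ _) (hint _ _)]
    push_cast
    rw [add_assoc]

theorem block_mem_language (x : Space ζ) (i : ℤ) (k : ℕ) : block x.1 i k ∈ language ζ := by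
  obtain ⟨K, a, h⟩ := x.2 (i.natAbs + k)
  refine ⟨K, a, List.IsInfix.trans ?_ h⟩
  obtain ⟨p, hp⟩ : ∃ p : ℕ, (p : ℤ) = i + (i.natAbs + k : ℕ) :=
    ⟨(i + (i.natAbs + k : ℕ)).toNat, by omega⟩
  obtain ⟨q, hq⟩ : ∃ q : ℕ, 2 * (i.natAbs + k) + 1 = p + k + q :=
    ⟨2 * (i.natAbs + k) + 1 - (p + k), by omega⟩
  rw [hq]
  have : i = -((i.natAbs + k : ℕ) : ℤ) + p := by omega
  conv_lhs => rw [this]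
  exact block_infix x.1 _ p k q

theorem mul_le_roofSum_sub {c : ℝ} (hc : ∀ a, c ≤ s a) (x : ℤ → Fin m) (p : ℤ) (k : ℕ) :
    c * k ≤ roofSum s x (p + k) - roofSum s x p := by
  induction k with
  | zero => simp
  | succ k ih =>
    push_cast
    rw [← add_assoc, roofSum_succ]
    linarith [hc (x (p + k))]

/-- Integrals of a cylindrical function along an orbit are, up to two boundary terms, sums over a
word of the language. -/
theorem exists_word_norm_integral_fibre_le (hs : ∀ a, 0 < s a) (hs1 : ∀ a, s a ≤ 1) {c : ℝ}
    (hc0 : 0 < c) (hc : ∀ a, c ≤ s a) {ψ : Fin m → ℝ → ℂ} {M : ℝ} (hψ : ∀ a, Measurable (ψ a))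
    (hM : ∀ a t, ‖ψ a t‖ ≤ M) (x : Space ζ) (u : ℝ) {R : ℝ} (hR : 0 ≤ R) :
    ∃ w ∈ language ζ, (w.length : ℝ) ≤ (R + 1) / c ∧
      ‖∫ t in 0..R, fibre hs ψ x.1 (u + t)‖ ≤ 2 * M + ‖wordSum (letterIntegral s ψ) w‖ := by
  obtain ⟨p₁, p₂⟩ := roofIndex_spec hs x.1 u
  obtain ⟨q₁, q₂⟩ := roofIndex_spec hs x.1 (u + R)
  -- The word runs from the letter over which `u` lies up to, but excluding, the one over which `u +
  -- R` lies. Roofs are at most `1`, so each correction is at most `M` and the word spans height at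
  -- most `R + 1`.
  set p := roofIndex hs x.1 u
  set q := roofIndex hs x.1 (u + R)
  have hmono := roofSum_strictMono hs x.1
  have hpq : p ≤ q := by
    have := hmono.lt_iff_lt.mp (show roofSum s x.1 p < roofSum s x.1 (q + 1) by linarith)
    omega
  obtain ⟨k, hk⟩ := Int.le.dest hpq
  rw [roofSum_succ] at p₂ q₂
  have hp1 := hs1 (x.1 p)
  have hq1 := hs1 (x.1 q)
  have hM0 : 0 ≤ M := (norm_nonneg _).trans (hM (x.1 0) 0)
  refine ⟨block x.1 p k, block_mem_language x p k, ?_, ?_⟩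
  · have := mul_le_roofSum_sub hc x.1 p k
    rw [hk] at this
    rw [le_div_iff₀ hc0]
    simp only [block, List.length_map, List.length_range]
    linarith
  · have hint := intervalIntegrable_of_bounded (measurable_fibre_right hs hψ x)
      (norm_fibre_le hs hM x.1)
    have hshift : ∫ t in 0..R, fibre hs ψ x.1 (u + t) = ∫ t in u..u + R, fibre hs ψ x.1 t := by
      rw [intervalIntegral.integral_comp_add_left (fun t => fibre hs ψ x.1 t), add_zero]
    have hsplit : ∫ t in u..u + R, fibre hs ψ x.1 t
        = (∫ t in roofSum s x.1 p..roofSum s x.1 q, fibre hs ψ x.1 t)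
          - (∫ t in roofSum s x.1 p..u, fibre hs ψ x.1 t)
          + ∫ t in roofSum s x.1 q..u + R, fibre hs ψ x.1 t := by
      rw [← intervalIntegral.integral_add_adjacent_intervals (hint u (roofSum s x.1 q)) (hint _ _),
        ← intervalIntegral.integral_add_adjacent_intervals (hint (roofSum s x.1 p) u)
          (hint u (roofSum s x.1 q))]
      ring
    have hsmall : ∀ a b : ℝ, a ≤ b → b ≤ a + 1 → ‖∫ t in a..b, fibre hs ψ x.1 t‖ ≤ M := by
      intro a b hab hb
      refine (intervalIntegral.norm_integral_le_of_norm_le_const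
        fun t _ => norm_fibre_le hs hM x.1 t).trans ?_
      rw [abs_of_nonneg (by linarith)]
      exact mul_le_of_le_one_right hM0 (by linarith)
    rw [hshift, hsplit, ← hk, integral_fibre_block hs hψ hM x p k, hk]
    have h1 := hsmall _ _ p₁ (by linarith)
    have h2 := hsmall _ _ q₁ (by linarith)
    refine (norm_add_le _ _).trans ?_
    have := norm_sub_le (wordSum (letterIntegral s ψ) (block x.1 p k))
      (∫ t in roofSum s x.1 p..u, fibre hs ψ x.1 t)
    linarith

end Fibre

/-! ### Integration over the suspension -/

section Suspension

variable {m : ℕ} {s : Fin m → ℝ} {ζ : Substitution m} {μ : Measure (Space ζ)}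

theorem measurableSet_suspension (ζ : Substitution m) (s : Fin m → ℝ) :
    MeasurableSet (suspension ζ s) :=
  (measurableSet_le measurable_const measurable_snd).inter
    (measurableSet_lt measurable_snd
      (((Measurable.of_discrete (f := s)).comp (measurable_coord 0)).comp measurable_fst))

theorem prod_suspension_lt_top [IsProbabilityMeasure μ] (hs1 : ∀ a, s a ≤ 1) :
    (μ.prod volume) (suspension ζ s) < ⊤ := by
  refine lt_of_le_of_lt (measure_mono (t := Set.univ ×ˢ Set.Icc (0 : ℝ) 1) ?_) ?_
  · rintro ⟨x, t⟩ ⟨h₁, h₂⟩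
    exact ⟨trivial, h₁, h₂.le.trans (hs1 _)⟩
  · rw [Measure.prod_prod]; simp

theorem setIntegral_suspension [IsProbabilityMeasure μ] (hs : ∀ a, 0 < s a) (hs1 : ∀ a, s a ≤ 1)
    {H : Space ζ → ℝ → ℂ} {M : ℝ} (hH : Measurable (Function.uncurry H))
    (hM : ∀ x u, ‖H x u‖ ≤ M) :
    ∫ p in suspension ζ s, H p.1 p.2 ∂(μ.prod volume) = ∫ x, (∫ u in 0..s (x.1 0), H x u) ∂μ := by
  have hint : IntegrableOn (fun p : Space ζ × ℝ => H p.1 p.2) (suspension ζ s) (μ.prod volume) :=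
    Measure.integrableOn_of_bounded (M := M) (prod_suspension_lt_top hs1).ne
      hH.aestronglyMeasurable (Filter.Eventually.of_forall fun p => hM p.1 p.2)
  rw [← integral_indicator (measurableSet_suspension ζ s),
    integral_prod _ (hint.integrable_indicator (measurableSet_suspension ζ s))]
  refine integral_congr_ae (Filter.Eventually.of_forall fun x => ?_)
  simp only
  rw [intervalIntegral.integral_of_le (hs _).le, ← integral_Ico_eq_integral_Ioc,
    ← integral_indicator measurableSet_Ico]
  congr 1

theorem measurable_intervalIntegral {H : Space ζ → ℝ → ℂ} (hH : Measurable (Function.uncurry H))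
    (a b : ℝ) : Measurable fun x => ∫ u in a..b, H x u := by
  have h : ∀ ν : Measure ℝ, [SFinite ν] → Measurable fun x => ∫ u, H x u ∂ν := fun ν _ =>
    (hH.stronglyMeasurable.integral_prod_right' (ν := ν)).measurable
  simp only [intervalIntegral]
  exact (h _).sub (h _)

/-- The integral over the suspension of a function which is equivariant under the shift does not
change under vertical translations. -/
theorem integral_roof_translate [IsProbabilityMeasure μ] (hμ : MeasurePreserving (shift ζ 1) μ μ)
    (hs : ∀ a, 0 < s a) (hs1 : ∀ a, s a ≤ 1)
    {H : Space ζ → ℝ → ℂ} {M : ℝ} (hH : Measurable (Function.uncurry H))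
    (hM : ∀ x u, ‖H x u‖ ≤ M) (hequi : ∀ x u, H (shift ζ 1 x) u = H x (u + s (x.1 0))) (τ : ℝ) :
    ∫ x, (∫ u in 0..s (x.1 0), H x (u + τ)) ∂μ = ∫ x, (∫ u in 0..s (x.1 0), H x u) ∂μ := by
  have hHx : ∀ x, Measurable (H x) := fun x => hH.comp measurable_prodMk_left
  have hint := fun x => intervalIntegrable_of_bounded (hHx x) (hM x)
  -- Moving the window `[0, s_{x₀}]` up by `τ` changes the integral by the coboundary `J(Tx) -
  -- J(x)`, whose mean is zero by invariance of `μ`.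
  set J : Space ζ → ℂ := fun x => ∫ u in 0..τ, H x u with hJ
  have hJm : Measurable J := measurable_intervalIntegral hH 0 τ
  have hJi : Integrable J μ := by
    refine Integrable.of_bound hJm.aestronglyMeasurable (M * |τ|)
      (Filter.Eventually.of_forall fun x => ?_)
    simpa using intervalIntegral.norm_integral_le_of_norm_le_const
      (a := 0) (b := τ) fun u _ => hM x u
  have hI : Integrable (fun x => ∫ u in 0..s (x.1 0), H x u) μ := by
    have hm : Measurable fun q : Fin m × Space ζ => ∫ u in 0..s q.1, H q.2 u :=
      measurable_from_prod_countable_right fun a => measurable_intervalIntegral hH 0 (s a)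
    refine Integrable.of_bound
      (hm.comp ((measurable_coord 0).prodMk measurable_id)).aestronglyMeasurable M
      (Filter.Eventually.of_forall fun x => ?_)
    have hM0 : 0 ≤ M := (norm_nonneg _).trans (hM x 0)
    refine (intervalIntegral.norm_integral_le_of_norm_le_const fun u _ => hM x u).trans ?_
    rw [sub_zero, abs_of_pos (hs _)]
    exact mul_le_of_le_one_right hM0 (hs1 _)
  have hJT : ∫ x, J (shift ζ 1 x) ∂μ = ∫ x, J x ∂μ := by
    conv_rhs => rw [← hμ.map_eq]
    exact (integral_map hμ.measurable.aemeasurable hJm.aestronglyMeasurable).symm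
  have hJTi : Integrable (fun x => J (shift ζ 1 x)) μ := hμ.integrable_comp_of_integrable hJi
  have hpt : ∀ x : Space ζ, ∫ u in 0..s (x.1 0), H x (u + τ)
      = (∫ u in 0..s (x.1 0), H x u) + (J (shift ζ 1 x) - J x) := by
    intro x
    have h1 : J (shift ζ 1 x) = ∫ u in s (x.1 0)..s (x.1 0) + τ, H x u := by
      simp only [hJ, hequi]
      rw [intervalIntegral.integral_comp_add_right (fun u => H x u), zero_add, add_comm τ]
    rw [intervalIntegral.integral_comp_add_right (fun u => H x u), zero_add, h1, ← add_sub_assoc,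
      intervalIntegral.integral_add_adjacent_intervals (hint x _ _) (hint x _ _),
      ← intervalIntegral.integral_add_adjacent_intervals (hint x 0 τ) (hint x _ _)]
    simp only [hJ]
    ring
  simp only [hpt]
  have hd : Integrable (fun x => J (shift ζ 1 x) - J x) μ := hJTi.sub hJi
  rw [integral_add hI hd, integral_sub hJTi hJi, hJT, sub_self, add_zero]

theorem integral_suspMeasure (H : Space ζ × ℝ → ℂ) :
    ∫ y : suspension ζ s, H y.1 ∂(suspMeasure ζ s μ)
      = ((μ.prod volume) (suspension ζ s))⁻¹.toReal *
        ∫ p in suspension ζ s, H p ∂(μ.prod volume) := by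
  have h1 : suspMeasure₀ ζ s μ Set.univ = (μ.prod volume) (suspension ζ s) := by
    rw [suspMeasure₀, (MeasurableEmbedding.subtype_coe
      (measurableSet_suspension ζ s)).comap_apply]
    simp
  rw [suspMeasure, integral_smul_measure, h1, suspMeasure₀,
    integral_subtype_comap (measurableSet_suspension ζ s) H, Complex.real_smul]

theorem prod_suspension_ne_zero [IsProbabilityMeasure μ] (hs : ∀ a, 0 < s a) :
    (μ.prod volume) (suspension ζ s) ≠ 0 := by
  intro h0
  rw [Measure.prod_apply (measurableSet_suspension ζ s),
    lintegral_eq_zero_iff (measurable_measure_prodMk_left (measurableSet_suspension ζ s))] at h0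
  obtain ⟨x, hx⟩ := h0.exists
  have : Prod.mk x ⁻¹' suspension ζ s = Set.Ico 0 (s (x.1 0)) := rfl
  simp only [this, Real.volume_Ico, Pi.zero_apply, ENNReal.ofReal_eq_zero] at hx
  linarith [hs (x.1 0)]

/-- Correlations of a cylindrical function along the flow depend on the time difference only. -/
theorem integral_correlation [IsProbabilityMeasure μ] (hμ : MeasurePreserving (shift ζ 1) μ μ)
    (hs : ∀ a, 0 < s a) (hs1 : ∀ a, s a ≤ 1) {ψ : Fin m → ℝ → ℂ} {M : ℝ}
    (hψ : ∀ a, Measurable (ψ a)) (hM : ∀ a t, ‖ψ a t‖ ≤ M) (t τ : ℝ) :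
    ∫ p in suspension ζ s, fibre hs ψ p.1.1 (p.2 + t) *
        (starRingEnd ℂ) (fibre hs ψ p.1.1 (p.2 + τ)) ∂(μ.prod volume)
      = ∫ p in suspension ζ s, fibre hs ψ p.1.1 (p.2 + (t - τ)) *
        (starRingEnd ℂ) (fibre hs ψ p.1.1 p.2) ∂(μ.prod volume) := by
  have hF := measurable_fibre (ζ := ζ) hs hψ
  have htr : ∀ c : ℝ, Measurable fun p : Space ζ × ℝ => fibre hs ψ p.1.1 (p.2 + c) := fun c =>
    hF.comp (measurable_fst.prodMk (measurable_snd.add_const c))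
  set H : Space ζ → ℝ → ℂ := fun x u =>
    fibre hs ψ x.1 (u + (t - τ)) * (starRingEnd ℂ) (fibre hs ψ x.1 u) with hHdef
  have hH : Measurable (Function.uncurry H) :=
    (htr (t - τ)).mul (Complex.continuous_conj.measurable.comp hF)
  have hHM : ∀ x u, ‖H x u‖ ≤ M * M := fun x u => by
    have hM0 : 0 ≤ M := (norm_nonneg _).trans (hM (x.1 0) 0)
    rw [hHdef, norm_mul, RCLike.norm_conj]
    exact mul_le_mul (norm_fibre_le hs hM _ _) (norm_fibre_le hs hM _ _) (norm_nonneg _) hM0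
  have hequi : ∀ x u, H (shift ζ 1 x) u = H x (u + s (x.1 0)) := fun x u => by
    simp only [hHdef, shift, fibre_shift]
    rw [add_right_comm]
  have hmain := integral_roof_translate hμ hs hs1 hH hHM hequi τ
  rw [← setIntegral_suspension hs hs1 hH hHM,
    ← setIntegral_suspension (H := fun x u => H x (u + τ)) hs hs1
      (hH.comp (measurable_fst.prodMk (measurable_snd.add_const τ))) (fun x u => hHM x _)] at hmain
  rw [← hmain]
  refine integral_congr_ae (Filter.Eventually.of_forall fun p => ?_)
  simp only [hHdef]
  rw [add_assoc, add_sub_cancel]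

theorem integral_suspension_fibre [IsProbabilityMeasure μ] (hs : ∀ a, 0 < s a)
    (hs1 : ∀ a, s a ≤ 1) {ψ : Fin m → ℝ → ℂ} {M : ℝ}
    (hψ : ∀ a, Measurable (ψ a)) (hM : ∀ a t, ‖ψ a t‖ ≤ M) :
    ∫ p in suspension ζ s, fibre hs ψ p.1.1 p.2 ∂(μ.prod volume)
      = ∫ x, letterIntegral s ψ (x.1 0) ∂μ := by
  rw [setIntegral_suspension (H := fun x u => fibre hs ψ x.1 u) hs hs1 (measurable_fibre hs hψ)
    (fun x u => norm_fibre_le hs hM x.1 u)]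
  refine integral_congr_ae (Filter.Eventually.of_forall fun x => ?_)
  have := integral_fibre_letter hs ψ x.1 0
  rwa [roofSum_succ, roofSum_zero, zero_add] at this

theorem integrable_coord [IsProbabilityMeasure μ] (v : Fin m → ℂ) (n : ℤ) :
    Integrable (fun x : Space ζ => v (x.1 n)) μ :=
  Integrable.of_bound
    ((Measurable.of_discrete (f := v)).comp (measurable_coord n)).aestronglyMeasurable (∑ a, ‖v a‖)
    (Filter.Eventually.of_forall fun _ => Finset.single_le_sum (f := fun a => ‖v a‖)
      (fun _ _ => norm_nonneg _) (Finset.mem_univ _))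

theorem integral_coord [IsProbabilityMeasure μ] (hμ : MeasurePreserving (shift ζ 1) μ μ)
    (v : Fin m → ℂ) (n : ℕ) : ∫ x : Space ζ, v (x.1 n) ∂μ = ∫ x : Space ζ, v (x.1 0) ∂μ := by
  induction n with
  | zero => rfl
  | succ n ih =>
    rw [← ih]
    conv_rhs => rw [← hμ.map_eq]
    rw [integral_map hμ.measurable.aemeasurable (by
      rw [hμ.map_eq]; exact (integrable_coord v n).aestronglyMeasurable)]
    simp [shift]

theorem integral_wordSum_block [IsProbabilityMeasure μ] (hμ : MeasurePreserving (shift ζ 1) μ μ)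
    (v : Fin m → ℂ) (N : ℕ) : Integrable (fun x : Space ζ => wordSum v (block x.1 0 N)) μ ∧
      ∫ x : Space ζ, wordSum v (block x.1 0 N) ∂μ = N * ∫ x : Space ζ, v (x.1 0) ∂μ := by
  induction N with
  | zero => simp [block]
  | succ N ih =>
    simp only [block_succ, wordSum_append, wordSum_cons, wordSum_nil, add_zero, zero_add]
    refine ⟨ih.1.add (integrable_coord v N), ?_⟩
    rw [integral_add ih.1 (integrable_coord v N), ih.2, integral_coord hμ]
    push_cast; ring

/-- If the sums of `v` over words of the language grow slower than the length then `v` has mean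
zero. -/
theorem integral_coord_eq_zero [IsProbabilityMeasure μ] (hμ : MeasurePreserving (shift ζ 1) μ μ)
    {v : Fin m → ℂ} {K R ρ : ℝ} {α : ℕ} (hR : 0 < R) (hRρ : R < ρ) (hρ : 1 < ρ)
    (h : ∀ w ∈ language ζ, ∀ j : ℕ, (w.length : ℝ) ≤ ρ ^ j →
      ‖wordSum v w‖ ≤ K * (j + 1) ^ α * R ^ j) :
    ∫ x : Space ζ, v (x.1 0) ∂μ = 0 := by
  by_contra hne
  refine not_forall_pow_le (K := K) α hR hRρ (c := ‖∫ x : Space ζ, v (x.1 0) ∂μ‖ / 2)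
    (by positivity) fun j => ?_
  have h1 : (1 : ℝ) ≤ ρ ^ j := one_le_pow₀ hρ.le
  -- Stationarity gives `N * ‖∫ v‖ ≤ K (j+1)^α R^j`, while `N ≥ ρ ^ j / 2` and `R < ρ`; hence the
  -- constant `c` above is half the norm of the mean.
  set N := ⌊ρ ^ j⌋₊
  have hN : (N : ℝ) ≤ ρ ^ j := Nat.floor_le (by positivity)
  have hN2 : ρ ^ j ≤ 2 * N := by
    have h2 := Nat.lt_floor_add_one (ρ ^ j)
    have h3 : (1 : ℝ) ≤ N := by exact_mod_cast (Nat.one_le_floor_iff _).mpr h1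
    linarith
  have hb : ‖∫ x : Space ζ, wordSum v (block x.1 0 N) ∂μ‖ ≤ K * (j + 1) ^ α * R ^ j := by
    have := norm_integral_le_of_norm_le_const (μ := μ)
      (f := fun x : Space ζ => wordSum v (block x.1 0 N)) (C := K * (j + 1) ^ α * R ^ j)
      (Filter.Eventually.of_forall fun x => h _ (block_mem_language x 0 N) j (by
        simpa [block] using hN))
    simpa using this
  rw [(integral_wordSum_block hμ v N).2, norm_mul, Complex.norm_natCast] at hb
  have := norm_nonneg (∫ x : Space ζ, v (x.1 0) ∂μ)
  nlinarith

end Suspension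

/-! ### Spectral measures -/

/-- The mean square of an average, as a double integral of correlations. -/
theorem integral_norm_sq_integral {Y : Type*} [MeasurableSpace Y] (ν : Measure Y)
    [IsFiniteMeasure ν] (l : Measure ℝ) [IsFiniteMeasure l] {G : Y → ℝ → ℂ} {M : ℝ}
    (hG : Measurable (Function.uncurry G)) (hM : ∀ y t, ‖G y t‖ ≤ M) :
    ∫ y, ((‖∫ t, G y t ∂l‖ ^ 2 : ℝ) : ℂ) ∂ν
      = ∫ p : ℝ × ℝ, ∫ y, G y p.1 * (starRingEnd ℂ) (G y p.2) ∂ν ∂(l.prod l) := by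
  have h1 : ∀ y, ((‖∫ t, G y t ∂l‖ ^ 2 : ℝ) : ℂ)
      = ∫ p : ℝ × ℝ, G y p.1 * (starRingEnd ℂ) (G y p.2) ∂(l.prod l) := fun y => by
    rw [integral_prod_mul (fun t => G y t) (fun t => (starRingEnd ℂ) (G y t)), integral_conj,
      Complex.mul_conj, Complex.normSq_eq_norm_sq]
  simp only [h1]
  refine integral_integral_swap (Integrable.of_bound (C := M * M) ?_ ?_)
  · have h2 : Measurable fun q : Y × (ℝ × ℝ) => G q.1 q.2.1 :=
      hG.comp (measurable_fst.prodMk (measurable_fst.comp measurable_snd))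
    have h3 : Measurable fun q : Y × (ℝ × ℝ) => G q.1 q.2.2 :=
      hG.comp (measurable_fst.prodMk (measurable_snd.comp measurable_snd))
    exact (h2.mul (Complex.continuous_conj.measurable.comp h3)).aestronglyMeasurable
  · refine Filter.Eventually.of_forall fun q => ?_
    rw [Function.uncurry, norm_mul, RCLike.norm_conj]
    exact mul_le_mul (hM _ _) (hM _ _) (norm_nonneg _) ((norm_nonneg _).trans (hM q.1 0))

theorem norm_exp_two_pi (ω t : ℝ) : ‖Complex.exp (2 * Real.pi * Complex.I * ω * t)‖ = 1 := by
  have : (2 * Real.pi * Complex.I * ω * t : ℂ) = ((2 * Real.pi * ω * t : ℝ) : ℂ) * Complex.I := by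
    push_cast; ring
  rw [this, Complex.norm_exp_ofReal_mul_I]

/-- On the whole range the phase is at most `1` in absolute value, where the cosine is at least
`1/2`. -/
theorem half_le_norm_integral_exp {R ω : ℝ} (hR : 0 ≤ R) (h : 2 * Real.pi * |ω| * R ≤ 1) :
    R / 2 ≤ ‖∫ t in 0..R, Complex.exp (2 * Real.pi * Complex.I * ω * t)‖ := by
  have hcont : Continuous fun t : ℝ => Complex.exp (2 * Real.pi * Complex.I * ω * t) := by fun_prop
  refine le_trans ?_ (Complex.re_le_norm _)
  have hre : (∫ t in 0..R, Complex.exp (2 * Real.pi * Complex.I * ω * t)).re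
      = ∫ t in 0..R, Real.cos (2 * Real.pi * ω * t) := by
    have := intervalIntegral.intervalIntegral_re (𝕜 := ℂ) (hcont.intervalIntegrable (μ := volume) 0 R)
    simp only [RCLike.re_to_complex] at this
    rw [← this]
    congr 1
    ext t
    have e : (2 * Real.pi * Complex.I * ω * t : ℂ) = ((2 * Real.pi * ω * t : ℝ) : ℂ) * Complex.I := by
      push_cast; ring
    rw [e, Complex.exp_ofReal_mul_I_re]
  rw [hre]
  have hc : ∫ _ in (0 : ℝ)..R, (1 / 2 : ℝ) = R / 2 := by simp; ring
  rw [← hc]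
  refine intervalIntegral.integral_mono_on hR (by simp)
    ((by fun_prop : Continuous fun t : ℝ => Real.cos (2 * Real.pi * ω * t)).intervalIntegrable _ _)
    fun t ht => ?_
  have h1 := Real.one_sub_sq_div_two_le_cos (x := 2 * Real.pi * ω * t)
  have h2 : |2 * Real.pi * ω * t| ≤ 1 := by
    rw [abs_mul, abs_mul, abs_of_pos (by positivity : 0 < 2 * Real.pi), abs_of_nonneg ht.1]
    refine le_trans ?_ h
    gcongr
    exact ht.2
  have h3 : (2 * Real.pi * ω * t) ^ 2 ≤ 1 := by
    rw [← sq_abs]; exact pow_le_one₀ (abs_nonneg _) h2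
  linarith

/-- The mass of an interval around zero under a spectral measure is controlled by the ergodic
integrals of length comparable with the inverse of the interval. -/
theorem spectral_mass_le {m : ℕ} {s : Fin m → ℝ} {ζ : Substitution m} {μ : Measure (Space ζ)}
    [IsProbabilityMeasure μ] (hμ : MeasurePreserving (shift ζ 1) μ μ)
    (hs : ∀ a, 0 < s a) (hs1 : ∀ a, s a ≤ 1) {ψ : Fin m → ℝ → ℂ} {M : ℝ}
    (hψ : ∀ a, Measurable (ψ a)) (hM : ∀ a t, ‖ψ a t‖ ≤ M) {σ : Measure ℝ}
    (hσ : IsSpectralMeasure (suspMeasure ζ s μ) (flow ζ hs) (cylindrical ζ s ψ) σ)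
    {r R b : ℝ} (hr : 0 < r) (hR : R = 1 / (2 * Real.pi * r))
    (hb : ∀ (x : Space ζ) u, ‖∫ t in 0..R, fibre hs ψ x.1 (u + t)‖ ≤ b) :
    σ.real (Set.Icc (-r) r) * (R / 2) ^ 2 ≤ b ^ 2 := by
  obtain ⟨hfin, hσ⟩ := hσ
  have hR0 : 0 < R := by rw [hR]; positivity
  have hF := measurable_fibre (ζ := ζ) hs hψ
  set l : Measure ℝ := volume.restrict (Set.Ioc 0 R) with hl
  set Z := (μ.prod volume) (suspension ζ s) with hZ
  have hZ0 : Z ≠ 0 := prod_suspension_ne_zero hs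
  have hZt : Z ≠ ⊤ := (prod_suspension_lt_top hs1).ne
  set ν : Measure (Space ζ × ℝ) := Z⁻¹ • (μ.prod volume).restrict (suspension ζ s) with hν
  have hνp : IsProbabilityMeasure ν := by
    refine ⟨?_⟩
    rw [hν, Measure.smul_apply, Measure.restrict_apply_univ, smul_eq_mul]
    exact ENNReal.inv_mul_cancel hZ0 hZt
  have hνint : ∀ g : Space ζ × ℝ → ℂ, ∫ p, g p ∂ν
      = Z⁻¹.toReal * ∫ p in suspension ζ s, g p ∂(μ.prod volume) := fun g => by
    rw [hν, integral_smul_measure, Complex.real_smul]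
  set G : Space ζ × ℝ → ℝ → ℂ := fun p t => fibre hs ψ p.1.1 (p.2 + t) with hG
  have hGm : Measurable (Function.uncurry G) :=
    hF.comp ((measurable_fst.comp measurable_fst).prodMk
      ((measurable_snd.comp measurable_fst).add measurable_snd))
  set E : ℝ → ℝ → ℂ := fun ω t => Complex.exp (2 * Real.pi * Complex.I * ω * t) with hE
  have hEm : Measurable (Function.uncurry E) := by
    refine Continuous.measurable ?_
    simp only [hE, Function.uncurry_def]
    fun_prop
  -- Both correlations depend only on `t - τ`, where the definition of the spectral measure
  -- identifies them. Integrating over `t` and `τ` then equates the two mean squares.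
  have hcorr : ∀ t τ : ℝ, ∫ ω, E ω t * (starRingEnd ℂ) (E ω τ) ∂σ
      = ∫ p, G p t * (starRingEnd ℂ) (G p τ) ∂ν := by
    intro t τ
    have h1 : ∀ ω, E ω t * (starRingEnd ℂ) (E ω τ) = E ω (t - τ) := fun ω => by
      simp only [hE]
      rw [← Complex.exp_conj, ← Complex.exp_add]
      congr 1
      simp only [map_mul, Complex.conj_ofReal, Complex.conj_I, map_ofNat]
      push_cast; ring
    simp only [h1]
    rw [hνint, integral_correlation hμ hs hs1 hψ hM, hσ (t - τ),
      ← integral_suspMeasure (fun p : Space ζ × ℝ => fibre hs ψ p.1.1 (p.2 + (t - τ)) *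
        (starRingEnd ℂ) (fibre hs ψ p.1.1 p.2))]
    refine integral_congr_ae (Filter.Eventually.of_forall fun y => ?_)
    simp only
    rw [cylindrical_flow, cylindrical_eq_fibre ζ hs]
  have hkey : ∫ ω, ‖∫ t, E ω t ∂l‖ ^ 2 ∂σ = ∫ p, ‖∫ t, G p t ∂l‖ ^ 2 ∂ν := by
    have h1 := integral_norm_sq_integral σ l hEm (M := 1) fun ω t => (norm_exp_two_pi ω t).le
    have h2 := integral_norm_sq_integral ν l hGm fun p t => norm_fibre_le hs hM _ _
    simp only [hcorr] at h1
    rw [← h2, integral_complex_ofReal, integral_complex_ofReal] at h1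
    exact_mod_cast h1
  have hil : ∀ f : ℝ → ℂ, ∫ t, f t ∂l = ∫ t in 0..R, f t := fun f => by
    rw [intervalIntegral.integral_of_le hR0.le]
  have hEi : Integrable (fun ω => ‖∫ t, E ω t ∂l‖ ^ 2) σ := by
    have hm : Measurable fun ω => ∫ t, E ω t ∂l :=
      (hEm.stronglyMeasurable.integral_prod_right' (ν := l)).measurable
    refine Integrable.of_bound (hm.norm.pow_const 2).aestronglyMeasurable (R ^ 2)
      (Filter.Eventually.of_forall fun ω => ?_)
    rw [Real.norm_of_nonneg (by positivity)]
    gcongr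
    rw [hil]
    have := intervalIntegral.norm_integral_le_of_norm_le_const
      (a := 0) (b := R) fun t _ => (norm_exp_two_pi ω t).le
    rwa [one_mul, sub_zero, abs_of_pos hR0] at this
  have hlower : σ.real (Set.Icc (-r) r) * (R / 2) ^ 2 ≤ ∫ ω, ‖∫ t, E ω t ∂l‖ ^ 2 ∂σ := by
    calc σ.real (Set.Icc (-r) r) * (R / 2) ^ 2 = ∫ _ in Set.Icc (-r) r, (R / 2) ^ 2 ∂σ := by
          rw [setIntegral_const, smul_eq_mul]
      _ ≤ ∫ ω in Set.Icc (-r) r, ‖∫ t, E ω t ∂l‖ ^ 2 ∂σ := by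
          refine setIntegral_mono_on (integrable_const _).integrableOn hEi.integrableOn
            measurableSet_Icc fun ω hω => ?_
          gcongr
          rw [hil]
          refine half_le_norm_integral_exp hR0.le ?_
          have : |ω| ≤ r := abs_le.mpr hω
          calc 2 * Real.pi * |ω| * R ≤ 2 * Real.pi * r * R := by gcongr
            _ = 1 := by rw [hR]; field_simp
      _ ≤ _ := setIntegral_le_integral hEi (Filter.Eventually.of_forall fun ω => by positivity)
  refine hlower.trans ?_
  rw [hkey]
  have hup : ∀ p, ‖∫ t, G p t ∂l‖ ^ 2 ≤ b ^ 2 := fun p => by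
    rw [hil]
    gcongr
    exact hb p.1 p.2
  have := norm_integral_le_of_norm_le_const (μ := ν) (f := fun p => ‖∫ t, G p t ∂l‖ ^ 2)
    (C := b ^ 2) (Filter.Eventually.of_forall fun p => by
      rw [Real.norm_of_nonneg (by positivity)]; exact hup p)
  rw [probReal_univ, mul_one] at this
  exact (le_abs_self _).trans this

/-- The vector of letter frequencies is the Perron vector: a vector of mean zero annihilates it. -/
theorem dotProduct_eq_zero_of_integral_eq_zero {m : ℕ} {ζ : Substitution m} {μ : Measure (Space ζ)}
    [IsProbabilityMeasure μ] (hμ : MeasurePreserving (shift ζ 1) μ μ) {h l : Fin m → ℝ}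
    {ρ R K : ℝ} {α : ℕ} (hR : 1 < R) (hRρ : R < ρ) (hh : ∑ i, h i = 1) (hl : ∀ i, 0 < l i)
    (hle : l ᵥ* ζ.matrix.map (Nat.cast : ℕ → ℝ) = ρ • l)
    (hK : ∀ v : Fin m → ℂ, ∑ a, v a * h a = 0 → ∀ M, (∀ a, ‖v a‖ ≤ M) → ∀ (n : ℕ) b,
      ‖(v ᵥ* ζ.matrix.map (Nat.cast : ℕ → ℂ) ^ n) b‖ ≤ K * M * (n + 1) ^ α * R ^ n)
    {v : Fin m → ℂ} (hv : ∫ x : Space ζ, v (x.1 0) ∂μ = 0) : ∑ a, v a * h a = 0 := by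
  set c := ∑ a, v a * h a with hc
  -- Subtracting `c` makes the vector annihilate `h`, so its word sums are sublinear and its mean
  -- under `μ` vanishes. The mean of `v` is therefore `c`, without appeal to unique ergodicity.
  set v' : Fin m → ℂ := fun a => v a - c with hv'
  have hv'h : ∑ a, v' a * h a = 0 := by
    simp only [hv', sub_mul, Finset.sum_sub_distrib, ← Finset.mul_sum, ← Complex.ofReal_sum, hh]
    simp [hc]
  obtain ⟨K', hK'⟩ := exists_wordSum_pow_bound (ζ := ζ) (K := K) (α := α)
    (by linarith : 0 < ρ) hR hl hle
  have hbd : ∀ a, ‖v' a‖ ≤ ∑ a, ‖v' a‖ := fun a =>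
    Finset.single_le_sum (f := fun a => ‖v' a‖) (fun _ _ => norm_nonneg _) (Finset.mem_univ a)
  have h0 := integral_coord_eq_zero hμ (v := v') (by linarith : 0 < R) hRρ (by linarith)
    (hK' v' _ (hK v' hv'h _ hbd))
  simp only [hv'] at h0
  rw [integral_sub (integrable_coord v 0) (integrable_const c), hv] at h0
  simpa using h0

/-- The numerical form of the bound on ergodic integrals. -/
theorem exists_log_rpow_bound {c β K : ℝ} (α : ℕ) (hc : 0 < c) (hc1 : c ≤ 1) (hβ : 0 ≤ β)
    (hK : 0 ≤ K) : ∃ C, ∀ M r : ℝ, 0 ≤ M → 0 < r → r ≤ 1 / 2 →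
      2 * M + K * M * (1 + Real.log (1 / (c * r))) ^ α * (1 / (c * r)) ^ β
        ≤ C * M * Real.log (1 / r) ^ α * (r ^ β)⁻¹ := by
  have hl2 : 0 < Real.log 2 := Real.log_pos (by norm_num)
  have hlc : 0 ≤ Real.log (1 / c) := Real.log_nonneg (by rw [le_div_iff₀ hc]; linarith)
  -- As `log (1/r) ≥ log 2`, the constant `1 + log (1/c)` is absorbed into a multiple of `log
  -- (1/r)`.
  set d := (1 + Real.log (1 / c)) / Real.log 2 + 1 with hd
  refine ⟨2 * (Real.log 2 ^ α)⁻¹ + K * d ^ α * (c ^ β)⁻¹, fun M r hM hr hr2 => ?_⟩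
  have hl : Real.log 2 ≤ Real.log (1 / r) :=
    Real.log_le_log (by norm_num) (by rw [le_div_iff₀ hr]; linarith)
  have h1 : 1 + Real.log (1 / (c * r)) ≤ d * Real.log (1 / r) := by
    have e : (1 : ℝ) / (c * r) = 1 / c * (1 / r) := by field_simp
    rw [e, Real.log_mul (by positivity) (by positivity), hd, add_mul, one_mul, div_mul_eq_mul_div]
    have : 1 + Real.log (1 / c) ≤ (1 + Real.log (1 / c)) * Real.log (1 / r) / Real.log 2 := by
      rw [le_div_iff₀ hl2]; gcongr
    linarith
  have h2 : (1 / (c * r)) ^ β = (c ^ β)⁻¹ * (r ^ β)⁻¹ := by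
    rw [one_div, Real.inv_rpow (by positivity), Real.mul_rpow hc.le hr.le, mul_inv]
  have h3 : 1 ≤ (r ^ β)⁻¹ := (one_le_inv₀ (by positivity)).mpr
    (Real.rpow_le_one hr.le (by linarith) hβ)
  have h4 : 1 ≤ (Real.log 2 ^ α)⁻¹ * Real.log (1 / r) ^ α := by
    rw [inv_mul_eq_div, one_le_div (by positivity)]; gcongr
  have h5 : 0 ≤ 1 + Real.log (1 / (c * r)) := by
    have : 0 ≤ Real.log (1 / (c * r)) := by
      refine Real.log_nonneg ?_
      rw [le_div_iff₀ (by positivity)]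
      nlinarith
    linarith
  have h6 : 1 ≤ (Real.log 2 ^ α)⁻¹ * Real.log (1 / r) ^ α * (r ^ β)⁻¹ :=
    one_le_mul_of_one_le_of_one_le h4 h3
  calc 2 * M + K * M * (1 + Real.log (1 / (c * r))) ^ α * (1 / (c * r)) ^ β
      ≤ 2 * M * ((Real.log 2 ^ α)⁻¹ * Real.log (1 / r) ^ α * (r ^ β)⁻¹)
        + K * M * (d * Real.log (1 / r)) ^ α * ((c ^ β)⁻¹ * (r ^ β)⁻¹) := by
        rw [h2]
        refine add_le_add (le_mul_of_one_le_right (by positivity) h6) ?_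
        gcongr
    _ = _ := by rw [mul_pow]; ring

/-- The decay at zero of the spectral measures of mean-zero cylindrical functions, given the growth
of the powers of the substitution matrix on the annihilator of its Perron vector. -/
theorem exists_spectral_bound {m : ℕ} {ζ : Substitution m} {μ : Measure (Space ζ)}
    [IsProbabilityMeasure μ] (hμ : MeasurePreserving (shift ζ 1) μ μ) {h l : Fin m → ℝ}
    {ρ R K : ℝ} {α : ℕ} (hR : 1 < R) (hRρ : R < ρ) (hh : ∑ i, h i = 1) (hl : ∀ i, 0 < l i)
    (hle : l ᵥ* ζ.matrix.map (Nat.cast : ℕ → ℝ) = ρ • l)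
    (hK : ∀ v : Fin m → ℂ, ∑ a, v a * h a = 0 → ∀ M, (∀ a, ‖v a‖ ≤ M) → ∀ (n : ℕ) b,
      ‖(v ᵥ* ζ.matrix.map (Nat.cast : ℕ → ℂ) ^ n) b‖ ≤ K * M * (n + 1) ^ α * R ^ n)
    {s : Fin m → ℝ} (hs : ∀ a, 0 < s a) (hs1 : ∀ a, s a ≤ 1) :
    ∃ C : ℝ, ∀ ψ : Fin m → ℝ → ℂ, (∀ a, Measurable (ψ a)) →
      ∫ y, cylindrical ζ s ψ y ∂(suspMeasure ζ s μ) = 0 →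
      ∀ M : ℝ, (∀ a t, ‖ψ a t‖ ≤ M) → ∀ σ : Measure ℝ,
        IsSpectralMeasure (suspMeasure ζ s μ) (flow ζ hs) (cylindrical ζ s ψ) σ →
        ∀ r : ℝ, 0 < r → r ≤ 1 / 2 → σ.real (Set.Icc (-r) r) ≤
          C * M ^ 2 * Real.log (1 / r) ^ (2 * α) * r ^ (2 - 2 * Real.logb ρ R) := by
  obtain ⟨x₀⟩ : Nonempty (Space ζ) := μ.nonempty_of_neZero
  have : Nonempty (Fin m) := ⟨x₀.1 0⟩
  obtain ⟨a₀, ha₀⟩ := Finite.exists_min s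
  have hρ : 1 < ρ := hR.trans hRρ
  set c := s a₀
  have hc0 : 0 < c := hs a₀
  set β := Real.logb ρ R
  have hβ : 0 ≤ β := Real.logb_nonneg hρ hR.le
  obtain ⟨K', hK'0, hK'⟩ := exists_wordSum_bound (ζ := ζ) (K := K) (α := α) hR hρ hl hle
  obtain ⟨C, hC⟩ := exists_log_rpow_bound α hc0 (hs1 a₀) hβ hK'0
  -- The factor `16π²` is `1 / (T/2)²` divided by `r²`, for `T = 1/(2πr)`.
  refine ⟨16 * Real.pi ^ 2 * C ^ 2, fun ψ hψ hmean M hM σ hσ r hr hr2 => ?_⟩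
  have hM0 : 0 ≤ M := (norm_nonneg _).trans (hM a₀ 0)
  set v := letterIntegral s ψ with hv
  have hvM : ∀ a, ‖v a‖ ≤ M := fun a => by
    refine (intervalIntegral.norm_integral_le_of_norm_le_const fun t _ => hM a t).trans ?_
    rw [sub_zero, abs_of_pos (hs a)]
    exact mul_le_of_le_one_right hM0 (hs1 a)
  have hv0 : ∫ x : Space ζ, v (x.1 0) ∂μ = 0 := by
    simp only [cylindrical_eq_fibre ζ hs] at hmean
    rw [integral_suspMeasure (fun p => fibre hs ψ p.1.1 p.2),
      integral_suspension_fibre hs hs1 hψ hM, mul_eq_zero] at hmean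
    refine hmean.resolve_left ?_
    refine Complex.ofReal_ne_zero.mpr ?_
    exact (ENNReal.toReal_pos (ENNReal.inv_ne_zero.mpr (prod_suspension_lt_top hs1).ne)
      (ENNReal.inv_ne_top.mpr (prod_suspension_ne_zero hs))).ne'
  have hvh := dotProduct_eq_zero_of_integral_eq_zero hμ hR hRρ hh hl hle hK hv0
  have hword := hK' v M hM0 (hK v hvh M hvM)
  set T := 1 / (2 * Real.pi * r) with hT
  have hT0 : 0 < T := by positivity
  have hN1 : 1 ≤ 1 / (c * r) := by
    rw [le_div_iff₀ (by positivity)]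
    nlinarith [hs1 a₀]
  -- Both `T * r = 1/(2π)` and `r` are at most `1/2`, so `(T + 1) * r ≤ 1`.
  have hTN : (T + 1) / c ≤ 1 / (c * r) := by
    rw [div_le_div_iff₀ hc0 (by positivity)]
    have h1 : T * r ≤ 1 / 2 := by
      have : T * r = 1 / (2 * Real.pi) := by rw [hT]; field_simp
      rw [this]
      gcongr
      linarith [Real.pi_gt_three]
    nlinarith
  have hb : ∀ (x : Space ζ) u, ‖∫ t in 0..T, fibre hs ψ x.1 (u + t)‖
      ≤ C * M * Real.log (1 / r) ^ α * (r ^ β)⁻¹ := by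
    intro x u
    obtain ⟨w, hw, hlen, hle⟩ :=
      exists_word_norm_integral_fibre_le hs hs1 hc0 ha₀ hψ hM x u hT0.le
    exact (hle.trans (by gcongr; exact hword w hw _ hN1 (hlen.trans hTN))).trans (hC M r hM0 hr hr2)
  have hmass := spectral_mass_le hμ hs hs1 hψ hM hσ hr hT hb
  have hrp : r ^ (2 - 2 * β) = r ^ 2 * ((r ^ β)⁻¹) ^ 2 := by
    rw [Real.rpow_sub hr, mul_comm 2 β, Real.rpow_mul hr.le]
    norm_cast
    rw [inv_pow, div_eq_mul_inv]
  have hT2 : (T / 2) ^ 2 = (16 * Real.pi ^ 2 * r ^ 2)⁻¹ := by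
    rw [hT]; field_simp; norm_num
  rw [hT2, ← div_eq_mul_inv, div_le_iff₀ (by positivity)] at hmass
  refine hmass.trans (le_of_eq ?_)
  rw [hrp, pow_mul']
  ring

end SubstFlow

/-! ### The decay of the spectral measure at zero -/

theorem mainTheorem5 {m : ℕ} (ζ : SubstFlow.Substitution m) (hζ : ζ.IsPrimitive)
    (θ₁ θ₂ : ℂ) (rest : List ℂ) (hθ : ζ.IsEigenvalueList (θ₁ :: θ₂ :: rest))
    (hθ₂ : 1 < ‖θ₂‖)
    (α : ℕ) (hα : (θ₁ :: θ₂ :: rest).countP (fun z => ‖z‖ = ‖θ₂‖) = α + 1)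
    (μ : MeasureTheory.Measure (SubstFlow.Space ζ)) [MeasureTheory.IsProbabilityMeasure μ]
    (hμ : MeasureTheory.MeasurePreserving (SubstFlow.shift ζ 1) μ μ)
    (s : Fin m → ℝ) (hs : s ∈ SubstFlow.roofSimplex m) :
    ∃ C : ℝ, ∀ ψ : Fin m → ℝ → ℂ,
      (∀ a, ∃ K, LipschitzOnWith K (ψ a) (Set.Icc 0 (s a))) →
      ∫ y, SubstFlow.cylindrical ζ s ψ y ∂(SubstFlow.suspMeasure ζ s μ) = 0 →
      ∀ M : ℝ, (∀ a, ∀ t ∈ Set.Icc 0 (s a), ‖ψ a t‖ ≤ M) →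
      ∀ σ : MeasureTheory.Measure ℝ,
        SubstFlow.IsSpectralMeasure (SubstFlow.suspMeasure ζ s μ) (SubstFlow.flow ζ hs.1)
          (SubstFlow.cylindrical ζ s ψ) σ →
        ∀ r : ℝ, 0 < r → r ≤ 1 / 2 →
          σ.real (Set.Icc (-r) r) ≤
            C * M ^ 2 * Real.log (1 / r) ^ (2 * α) * r ^ (2 - 2 * Real.logb ‖θ₁‖ ‖θ₂‖) := by
  have hmap : (ζ.matrix.map (Nat.cast : ℕ → ℝ)).map ((↑) : ℝ → ℂ)
      = ζ.matrix.map (Nat.cast : ℕ → ℂ) := by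
    ext i j; simp
  obtain ⟨hlt, h, l, -, hh, hl, hle, K, hK⟩ :=
    SubstFlow.exists_perron_data hζ (by rw [hmap]; exact hθ.1) hθ.2 hθ₂ hα
  rw [hmap] at hK
  have hs1 : ∀ a, s a ≤ 1 := fun a => by
    rw [← hs.2]
    exact Finset.single_le_sum (fun i _ => (hs.1 i).le) (Finset.mem_univ a)
  obtain ⟨C, hC⟩ := SubstFlow.exists_spectral_bound hμ hθ₂ hlt hh hl hle hK hs.1 hs1
  refine ⟨C, fun ψ hψ hmean M hM σ hσ => ?_⟩
  -- extend the functions continuously beyond the roof intervals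
  set φ : Fin m → ℝ → ℂ := fun a => Set.IccExtend (hs.1 a).le ((Set.Icc 0 (s a)).domRestrict (ψ a))
    with hφ
  -- The Lipschitz condition enters only here, through continuity on the roof interval.
  have hφm : ∀ a, Measurable (φ a) := fun a => by
    obtain ⟨k, hk⟩ := hψ a
    exact (hk.continuousOn.domRestrict.Icc_extend').measurable
  have hφM : ∀ a t, ‖φ a t‖ ≤ M := fun a t => hM a _ (Set.projIcc 0 (s a) (hs.1 a).le t).2
  have hcyl : SubstFlow.cylindrical ζ s φ = SubstFlow.cylindrical ζ s ψ := by
    ext y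
    exact Set.IccExtend_of_mem (hs.1 _).le _ ⟨y.2.1, y.2.2.le⟩
  exact hC φ hφm (by rw [hcyl]; exact hmean) M hφM σ (by rw [hcyl]; exact hσ)
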